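/- Let $U$ be a smooth (Hausdorff, second countable) finite-dimensional Riemannian manifold, possibly with smooth boundary, not necessarily complete or connected, and let $m\ge 0$ be an integer. Let $G_m(U)$ be the Grassmann bundle of pairs $(x,P)$ with $x\in U$ and $P$ an $m$-dimensional linear subspace of $\operatorname{Tan}(U,x)$, and let $\mathcal X_m(U)$ be the space of continuous, compactly supported maps $X$ assigning to each $(x,P)\in G_m(U)$ a vector $X(x,P)\in\operatorname{Tan}(U,x)$. A rectifiable $m$-varifold in $U$ is a Radon measure $V$ on $G_m(U)$ such that its associated measure $M$ (its image under $(x,P)\mapsto x$) is carried by a countable union of $m$-dimensional $C^1$ submanifolds of $U$ and is absolutely continuous with respect to $\mathcal H^m$, and such that $V$ is the image of $M$ under $x\mapsto (x,\operatorname{Tan}(M,x))$, where $\operatorname{Tan}(M,x)$ is the approximate tangent plane of $M$ at $x$. **Theorem.** Let $V_i$ ($i=1,2,\dots$) and $V$ be rectifiable $m$-varifolds in $U$ with $V_i\rightharpoonup V$ (i.e. $\int f\,dV_i\to\int f\,dV$ for every continuous compactly supported $f:G_m(U)\to\mathbb R$), and let $M_i$ and $M$ be the associated Radon measures on $U$.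 Let $p\in(1,\infty]$ and let $Y_i$ be Borel vectorfields on $U$ such that $$\sup_i \|Y_i 1_K\|_{L^p(M_i)}<\infty\qquad\text{for every compact }K\subset U.$$ Then there are a subsequence $i(j)$ and a Borel vectorfield $Y$ on $U$ in $L^p_{\mathrm{loc}}(M)$ such that $$\int X(x,\operatorname{Tan}(M_{i(j)},x))\cdot Y_{i(j)}(x)\,dM_{i(j)}(x)\ \longrightarrow\ \int X(x,\operatorname{Tan}(M,x))\cdot Y(x)\,dM(x)\qquad(*)$$ for every $X\in\mathcal X_m(U)$. Moreover, suppose that for every $i$, $Y_i(x)$ is perpendicular to $\operatorname{Tan}(M_i,x)$ for $M_i$-almost every $x$. Then, for every subsequence $i(j)$ and every Borel vectorfield $Y\in L^p_{\mathrm{loc}}(M)$ satisfying $(*)$ for all $X\in\mathcal X_m(U)$, $Y(x)$ is perpendicular to $\operatorname{Tan}(M,x)$ for $M$-almost every $x$. -/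

import Mathlib

open MeasureTheory Filter Set Bundle Manifold
open scoped Topology ENNReal ContDiff CompactlySupported

noncomputable section

section Grassmannian

variable {E : Type*} [NormedAddCommGroup E] [NormedSpace ℝ E]
  {H : Type*} [TopologicalSpace H] (I : ModelWithCorners ℝ E H) (m : ℕ)
  (U : Type*) [TopologicalSpace U] [ChartedSpace H U]

/-- The Grassmann bundle `G_m(U)`: pairs `(x, P)` of a point `x` of `U` and an `m`-dimensional
linear subspace `P` of the tangent space of `U` at `x`. -/
structure GrassmannBundle where
  /-- the base point `x` -/
  pt : U
  /-- the plane `P` -/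
  plane : Submodule ℝ (TangentSpace I pt)
  finrank_plane : Module.finrank ℝ plane = m

namespace GrassmannBundle

variable {I m U} [FiniteDimensional ℝ E] [RiemannianBundle (fun x : U => TangentSpace I x)]

instance finiteDimensional_tangentSpace (x : U) : FiniteDimensional ℝ (TangentSpace I x) :=
  inferInstanceAs (FiniteDimensional ℝ E)

/-- The orthogonal projection of the tangent space at `x` onto the plane `P`, with respect to the
Riemannian inner product, as an element of the bundle of endomorphisms of tangent spaces. -/
def proj (q : GrassmannBundle I m U) :
    TotalSpace (E →L[ℝ] E) (fun x : U => TangentSpace I x →L[ℝ] TangentSpace I x) :=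
  ⟨q.pt, q.plane.starProjection⟩

variable [IsManifold I 1 U]

/-- The usual topology of the Grassmann bundle: a plane is identified with the orthogonal
projection onto it, so that `G_m(U)` is a subspace of the vector bundle `End(TU)`. -/
instance : TopologicalSpace (GrassmannBundle I m U) :=
  TopologicalSpace.induced proj inferInstance

instance : MeasurableSpace (GrassmannBundle I m U) := borel _

instance : BorelSpace (GrassmannBundle I m U) := ⟨rfl⟩

theorem continuous_proj : Continuous (proj : GrassmannBundle I m U → _) :=
  continuous_induced_dom

theorem continuous_pt : Continuous (pt : GrassmannBundle I m U → U) :=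
  (FiberBundle.continuous_proj (E →L[ℝ] E)
    (fun x : U => TangentSpace I x →L[ℝ] TangentSpace I x)).comp continuous_proj

theorem measurable_pt [MeasurableSpace U] [BorelSpace U] :
    Measurable (pt : GrassmannBundle I m U → U) :=
  continuous_pt.measurable

end GrassmannBundle

end Grassmannian

section Rectifiable

variable {E : Type*} [NormedAddCommGroup E] [NormedSpace ℝ E]
  {H : Type*} [TopologicalSpace H] (I : ModelWithCorners ℝ E H) (m : ℕ) {U : Type*}

/-- `S` is an (embedded) `m`-dimensional `C^1` submanifold of `U`: near each of its points it is the
image of an open subset of `ℝ^m` under a `C^1` immersion that is a homeomorphism onto its image. -/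
def IsC1Submanifold [TopologicalSpace U] [ChartedSpace H U] (S : Set U) : Prop :=
  ∀ x ∈ S, ∃ W : Set U, IsOpen W ∧ x ∈ W ∧
    ∃ (Ω : Set (EuclideanSpace ℝ (Fin m))) (f : EuclideanSpace ℝ (Fin m) → U),
      IsOpen Ω ∧ f '' Ω = S ∩ W ∧
      ContMDiffOn 𝓘(ℝ, EuclideanSpace ℝ (Fin m)) I 1 f Ω ∧
      (∀ u ∈ Ω, Function.Injective (mfderiv 𝓘(ℝ, EuclideanSpace ℝ (Fin m)) I f u)) ∧
      Topology.IsEmbedding (Ω.domRestrict f)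

/-- `M` is the Radon measure of an `m`-dimensional rectifiable varifold: a Borel measure, finite on
compact sets, that is carried by a countable union of `m`-dimensional `C^1` submanifolds and is
absolutely continuous with respect to `m`-dimensional Hausdorff measure. -/
def IsRectifiableMeasure [EMetricSpace U] [ChartedSpace H U] [MeasurableSpace U] [BorelSpace U]
    (M : Measure U) : Prop :=
  IsFiniteMeasureOnCompacts M ∧
  (∃ S : ℕ → Set U, (∀ j, IsC1Submanifold I m (S j)) ∧ M (⋃ j, S j)ᶜ = 0) ∧
  M ≪ μH[(m : ℝ)]

variable [MeasurableSpace E] [BorelSpace E]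
  [TopologicalSpace U] [ChartedSpace H U] [MeasurableSpace U]

/-- The `m`-dimensional subspace `P` of `Tan(U,x)` is the approximate tangent plane of `M` at `x`:
as `r ↓ 0`, the measures `r⁻ᵐ M`, rescaled about `x` by the factor `1/r`, converge weakly to
`θ · 𝓗ᵐ ⌞ P` for some positive constant `θ`. The rescaling is done in the preferred chart at `x`,
through which `TangentSpace I x` is identified with the model space `E`. The norm of `E` which
normalizes `𝓗ᵐ` on `P` affects the constant `θ` only. -/
def IsApproxTangentPlane (M : Measure U) (x : U) (P : Submodule ℝ (TangentSpace I x)) : Prop :=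
  Module.finrank ℝ P = m ∧
  ∃ θ : ℝ, 0 < θ ∧ ∀ f : C_c(E, ℝ),
    Tendsto
      (fun r : ℝ => (r ^ m)⁻¹ *
        ∫ y in (extChartAt I x).source, f (r⁻¹ • (extChartAt I x y - extChartAt I x x)) ∂M)
      (𝓝[>] 0)
      (𝓝 (θ * ∫ v in {v : E | (show TangentSpace I x from v) ∈ P}, f v ∂μH[(m : ℝ)]))

open Classical in
/-- `Tan(M,x)`: the approximate tangent plane of `M` at `x`, where there is one (and the zero
subspace where there is none; for a rectifiable measure these points form a null set). -/
def approxTan (M : Measure U) (x : U) : Submodule ℝ (TangentSpace I x) :=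
  if h : ∃ P, IsApproxTangentPlane I m M x P then h.choose else ⊥

open Classical in
/-- The vectorfield `x ↦ X(x, Tan(M,x))` on `U` (zero where there is no tangent plane). -/
def evalTan {m : ℕ} (X : ∀ q : GrassmannBundle I m U, TangentSpace I q.pt) (M : Measure U)
    (x : U) : TangentSpace I x :=
  if h : Module.finrank ℝ (approxTan I m M x) = m then X ⟨x, approxTan I m M x, h⟩ else 0

end Rectifiable

section Fields

variable {E : Type*} [NormedAddCommGroup E] [NormedSpace ℝ E] [FiniteDimensional ℝ E]
  {H : Type*} [TopologicalSpace H] (I : ModelWithCorners ℝ E H) {m : ℕ} {U : Type*}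

/-- `X` belongs to `𝒳_m(U)`: it assigns continuously to each `(x, P)` in `G_m(U)` a vector of
`Tan(U,x)`, and has compact support. -/
def IsTestField [TopologicalSpace U] [ChartedSpace H U] [IsManifold I 1 U]
    [RiemannianBundle (fun x : U => TangentSpace I x)]
    (X : ∀ q : GrassmannBundle I m U, TangentSpace I q.pt) : Prop :=
  Continuous (fun q => (⟨q.pt, X q⟩ : TangentBundle I U)) ∧
  ∃ K : Set (GrassmannBundle I m U), IsCompact K ∧ ∀ q ∉ K, X q = 0

/-- `Y` is a Borel vectorfield on `U`. -/
def IsBorelField [TopologicalSpace U] [ChartedSpace H U] [IsManifold I 1 U] [MeasurableSpace U]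
    (Y : ∀ x : U, TangentSpace I x) : Prop :=
  @Measurable U (TangentBundle I U) _ (borel _) (fun x => ⟨x, Y x⟩)

/-- `‖Y 1_K‖` in `L^p(M)`, for the pointwise Riemannian norm (with value in `[0,∞]`). -/
def lpNormOn [TopologicalSpace U] [ChartedSpace H U] [MeasurableSpace U]
    [RiemannianBundle (fun x : U => TangentSpace I x)]
    (Y : ∀ x : U, TangentSpace I x) (p : ℝ≥0∞) (M : Measure U) (K : Set U) : ℝ≥0∞ :=
  eLpNorm (fun x => ‖Y x‖) p (M.restrict K)

/-- The Borel vectorfield `Y` belongs to `L^p_loc(M)`. -/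
def MemLpLocField [TopologicalSpace U] [ChartedSpace H U] [IsManifold I 1 U] [MeasurableSpace U]
    [RiemannianBundle (fun x : U => TangentSpace I x)]
    (Y : ∀ x : U, TangentSpace I x) (p : ℝ≥0∞) (M : Measure U) : Prop :=
  IsBorelField I Y ∧ ∀ K : Set U, IsCompact K → lpNormOn I Y p M K < ⊤

end Fields

section Varifold

variable {E : Type*} [NormedAddCommGroup E] [NormedSpace ℝ E] [FiniteDimensional ℝ E]
  {H : Type*} [TopologicalSpace H] {I : ModelWithCorners ℝ E H} {m : ℕ} {U : Type*}

/-- The measure on `U` associated to the varifold `V`: the image of `V` under `(x, P) ↦ x`. -/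
def varifoldWeight [TopologicalSpace U] [ChartedSpace H U] [IsManifold I 1 U] [MeasurableSpace U]
    [RiemannianBundle (fun x : U => TangentSpace I x)]
    (V : Measure (GrassmannBundle I m U)) : Measure U :=
  V.map GrassmannBundle.pt

/-- `V` is a rectifiable `m`-varifold in `U`: a Radon measure on `G_m(U)` whose associated measure
`M` on `U` is rectifiable, and such that `V` is the image of `M` under `x ↦ (x, Tan(M,x))`, i.e. `V`
is carried by the pairs `(x, P)` for which `P` is the approximate tangent plane of `M` at `x`. -/
structure IsRectifiableVarifold [MeasurableSpace E] [BorelSpace E]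
    [EMetricSpace U] [ChartedSpace H U] [IsManifold I 1 U] [MeasurableSpace U] [BorelSpace U]
    [RiemannianBundle (fun x : U => TangentSpace I x)]
    (V : Measure (GrassmannBundle I m U)) : Prop where
  finiteOnCompacts : IsFiniteMeasureOnCompacts V
  rectifiable_weight : IsRectifiableMeasure I m (varifoldWeight V)
  ae_tangent : ∀ᵐ q ∂V, IsApproxTangentPlane I m (varifoldWeight V) q.pt q.plane

/-- Weak convergence `V_i ⇀ V` of varifolds, tested against `C_c(G_m(U))`. -/
def VarifoldTendsto [TopologicalSpace U] [ChartedSpace H U] [IsManifold I 1 U]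
    [RiemannianBundle (fun x : U => TangentSpace I x)]
    (V : ℕ → Measure (GrassmannBundle I m U)) (W : Measure (GrassmannBundle I m U)) : Prop :=
  ∀ f : C_c(GrassmannBundle I m U, ℝ), Tendsto (fun i => ∫ q, f q ∂V i) atTop (𝓝 (∫ q, f q ∂W))

/-- The pairing `∫ X(x, Tan(M,x)) · Y(x) dM(x)`. -/
def tanPairing [MeasurableSpace E] [BorelSpace E]
    [TopologicalSpace U] [ChartedSpace H U] [MeasurableSpace U]
    [RiemannianBundle (fun x : U => TangentSpace I x)]
    (X : ∀ q : GrassmannBundle I m U, TangentSpace I q.pt) (Y : ∀ x : U, TangentSpace I x)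
    (M : Measure U) : ℝ :=
  ∫ x, inner ℝ (evalTan I X M x) (Y x) ∂M

/-- `Y(x)` is perpendicular to `Tan(M,x)` for `M`-almost every `x`. -/
def IsPerpTan [MeasurableSpace E] [BorelSpace E]
    [TopologicalSpace U] [ChartedSpace H U] [MeasurableSpace U]
    [RiemannianBundle (fun x : U => TangentSpace I x)]
    (m : ℕ) (Y : ∀ x : U, TangentSpace I x) (M : Measure U) : Prop :=
  ∀ᵐ x ∂M, ∀ v ∈ approxTan I m M x, inner ℝ v (Y x) = 0

end Varifold

end

noncomputable section

section WeakCompactness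

open scoped NNReal

variable {X : Type*} [TopologicalSpace X] [T2Space X] [LocallyCompactSpace X]
  [SecondCountableTopology X]

theorem exists_seq_continuousMap_dense_on_compacts (X : Type*) [TopologicalSpace X]
    [LocallyCompactSpace X] [SecondCountableTopology X] :
    ∃ D : ℕ → C(X, ℝ), ∀ (f : C(X, ℝ)) (K : Set X), IsCompact K → ∀ ε > 0,
      ∃ n, ∀ x ∈ K, |f x - D n x| < ε := by
  refine ⟨TopologicalSpace.denseSeq C(X, ℝ), fun f K hK ε hε => ?_⟩
  have h1 : Tendsto (fun g : C(X, ℝ) => g) (𝓝 f) (𝓝 f) := tendsto_id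
  rw [ContinuousMap.tendsto_iff_forall_isCompact_tendstoUniformlyOn] at h1
  have h2 := Metric.tendstoUniformlyOn_iff.1 (h1 K hK) ε hε
  obtain ⟨g, ⟨n, rfl⟩, hg⟩ :=
    (TopologicalSpace.denseRange_denseSeq C(X, ℝ)).inter_nhds_nonempty h2
  exact ⟨n, fun x hx => hg x hx⟩

variable [MeasurableSpace X] [BorelSpace X]

/-- Countably many sequences of finite measures, each of bounded mass and carried by a fixed compact
set, have a common weakly convergent subsequence. -/
theorem exists_subseq_tendsto_integral {κ : Type*} [Countable κ] (ν : κ → ℕ → FiniteMeasure X)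
    (K : κ → Set X) (hK : ∀ k, IsCompact (K k)) (C : κ → ℝ≥0)
    (hmass : ∀ k i, (ν k i).mass ≤ C k) (hsupp : ∀ k i, ν k i (K k)ᶜ = 0) :
    ∃ φ : ℕ → ℕ, StrictMono φ ∧ ∃ μ : κ → FiniteMeasure X,
      ∀ k (f : BoundedContinuousFunction X ℝ),
        Tendsto (fun j => ∫ x, f x ∂(ν k (φ j) : Measure X)) atTop
          (𝓝 (∫ x, f x ∂(μ k : Measure X))) := by
  obtain ⟨D, hD⟩ := exists_seq_continuousMap_dense_on_compacts X
  let a : ℕ → κ × ℕ → ℝ := fun i p => ∫ x in K p.1, D p.2 x ∂(ν p.1 i : Measure X)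
  have hbd : ∀ p : κ × ℕ, ∃ B : ℝ, ∀ i, |a i p| ≤ B := by
    rintro ⟨k, n⟩
    obtain ⟨B, hB⟩ := (hK k).exists_bound_of_continuousOn (D n).continuous.continuousOn
    refine ⟨max B 0 * C k, fun i => ?_⟩
    have h1 := norm_setIntegral_le_of_norm_le_const (μ := (ν k i : Measure X)) (C := max B 0)
      (measure_lt_top _ (K k)) (fun x hx => (hB x hx).trans (le_max_left _ _))
    refine h1.trans ?_
    gcongr
    refine le_trans ?_ (NNReal.coe_le_coe.2 (hmass k i))
    exact NNReal.coe_le_coe.2 ((ν k i).apply_le_mass (K k))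
  choose B hB using hbd
  obtain ⟨A, -, φ, hφ, hA⟩ := (isCompact_univ_pi (fun p => isCompact_Icc (a := -B p) (b := B p))
    ).tendsto_subseq (x := a) (fun i p _ => abs_le.1 (hB p i))
  refine ⟨φ, hφ, ?_⟩
  have key : ∀ k, ∃ μ : FiniteMeasure X, ∀ f : BoundedContinuousFunction X ℝ,
        Tendsto (fun j => ∫ x, f x ∂(ν k (φ j) : Measure X)) atTop
          (𝓝 (∫ x, f x ∂(μ : Measure X))) := by
    intro k
    obtain ⟨μ, -, hμ⟩ := isCompact_setOfPred_finiteMeasure_le_of_isCompact (C k) (hK k)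
      (f := map (fun j => ν k (φ j)) atTop)
      (by
        rw [le_principal_iff]
        exact mem_map.2 (Eventually.of_forall fun j => ⟨hmass k _, hsupp k _⟩))
    refine ⟨μ, fun f => ?_⟩
    have hcl : ClusterPt (∫ x, f x ∂(μ : Measure X))
        (map (fun j => ∫ x, f x ∂(ν k (φ j) : Measure X)) atTop) := by
      have hc : Continuous fun ρ : FiniteMeasure X => ∫ x, f x ∂(ρ : Measure X) :=
        continuous_iff_continuousAt.2 fun ρ =>
          FiniteMeasure.tendsto_iff_forall_integral_tendsto.1 tendsto_id f
      have := ClusterPt.map hμ hc.continuousAt (tendsto_map (x := map (fun j => ν k (φ j)) atTop))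
      rwa [map_map] at this
    refine le_nhds_of_cauchy_adhp ?_ hcl
    change CauchySeq _
    rw [Metric.cauchySeq_iff]
    intro ε hε
    obtain ⟨n, hn⟩ := hD f.toContinuousMap (K k) (hK k) (ε / (3 * (C k + 1))) (by positivity)
    have happ : ∀ j, dist (∫ x, f x ∂(ν k (φ j) : Measure X)) (a (φ j) (k, n)) ≤ ε / 3 := by
      intro j
      have hres : (ν k (φ j) : Measure X).restrict (K k) = (ν k (φ j) : Measure X) := by
        refine Measure.restrict_eq_self_of_ae_mem ?_
        have := (FiniteMeasure.null_iff_toMeasure_null _ _).1 (hsupp k (φ j))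
        exact this
      have h2 : ∫ x, f x ∂(ν k (φ j) : Measure X) = ∫ x in K k, f x ∂(ν k (φ j) : Measure X) := by
        rw [hres]
      rw [h2, dist_eq_norm, ← integral_sub]
      · refine (norm_setIntegral_le_of_norm_le_const (C := ε / (3 * (C k + 1)))
          (measure_lt_top _ (K k)) (fun x hx => (hn x hx).le)).trans ?_
        have h3 : (ν k (φ j) : Measure X).real (K k) ≤ C k :=
          (NNReal.coe_le_coe.2 ((ν k (φ j)).apply_le_mass (K k))).trans
            (NNReal.coe_le_coe.2 (hmass k (φ j)))
        calc ε / (3 * (C k + 1)) * (ν k (φ j) : Measure X).real (K k)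
            ≤ ε / (3 * (C k + 1)) * (C k + 1) := by
              gcongr
              linarith
          _ = ε / 3 := by field_simp
      · exact (f.continuous.continuousOn.integrableOn_compact (hK k))
      · exact ((D n).continuous.continuousOn.integrableOn_compact (hK k))
    have hcau : CauchySeq fun j => a (φ j) (k, n) :=
      (((continuous_apply (k, n)).tendsto A).comp hA).cauchySeq
    obtain ⟨N, hN⟩ := Metric.cauchySeq_iff.1 hcau (ε / 3) (by positivity)
    refine ⟨N, fun i hi j hj => ?_⟩
    have h4 := hN i hi j hj
    have h5 := happ i
    have h6 := happ j
    rw [dist_comm] at h6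
    have := dist_triangle4 (∫ x, f x ∂(ν k (φ i) : Measure X)) (a (φ i) (k, n)) (a (φ j) (k, n))
      (∫ x, f x ∂(ν k (φ j) : Measure X))
    linarith
  choose μ hμ using key
  exact ⟨μ, hμ⟩

theorem tendsto_eLpNorm_of_tendsto_integral {V : ℕ → Measure X} {W : Measure X}
    [∀ i, IsFiniteMeasureOnCompacts (V i)] [IsFiniteMeasureOnCompacts W]
    (hVW : ∀ f : C_c(X, ℝ), Tendsto (fun i => ∫ x, f x ∂V i) atTop (𝓝 (∫ x, f x ∂W)))
    {q : ℝ≥0∞} (hq : 1 ≤ q) (hq' : q ≠ ⊤) (f : C_c(X, ℝ)) :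
    Tendsto (fun i => eLpNorm f q (V i)) atTop (𝓝 (eLpNorm f q W)) := by
  have hq0 : 0 < q.toReal := ENNReal.toReal_pos (by positivity) hq'
  have hmem : ∀ μ : Measure X, IsFiniteMeasureOnCompacts μ → MemLp f q μ := fun μ _ =>
    f.continuous.memLp_of_hasCompactSupport f.hasCompactSupport
  let g : C_c(X, ℝ) :=
    { toFun := fun x => ‖f x‖ ^ q.toReal
      continuous_toFun := (f.continuous.norm).rpow_const fun x => Or.inr hq0.le
      hasCompactSupport' := f.hasCompactSupport.comp_left (g := fun t : ℝ => ‖t‖ ^ q.toReal)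
        (by simp [hq0.ne']) }
  have h1 := hVW g
  simp only [fun i => (hmem (V i) inferInstance).eLpNorm_eq_integral_rpow_norm
    (by positivity) hq', (hmem W inferInstance).eLpNorm_eq_integral_rpow_norm (by positivity) hq']
  exact ENNReal.tendsto_ofReal (h1.rpow_const (Or.inr (by positivity)))

/-- Hölder's inequality for the densities `y i` with respect to `V i` passes to the limit. -/
theorem eLpNorm_one_le_of_tendsto {V : ℕ → Measure X} {W : Measure X}
    [∀ i, IsFiniteMeasureOnCompacts (V i)] [IsFiniteMeasureOnCompacts W]
    (hVW : ∀ f : C_c(X, ℝ), Tendsto (fun i => ∫ x, f x ∂V i) atTop (𝓝 (∫ x, f x ∂W)))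
    {p q : ℝ≥0∞} [ENNReal.HolderConjugate p q] (hq' : q ≠ ⊤)
    {y : ℕ → X → ℝ} (hy : ∀ i, Measurable (y i)) (hy0 : ∀ i x, 0 ≤ y i x)
    {C : ℝ≥0∞} (hC : C ≠ ⊤) (hyC : ∀ i, eLpNorm (y i) p (V i) ≤ C)
    {ν : Measure X} [IsFiniteMeasureOnCompacts ν]
    (hν : ∀ f : C_c(X, ℝ), Tendsto (fun i => ∫ x, f x * y i x ∂V i) atTop (𝓝 (∫ x, f x ∂ν)))
    (f : C_c(X, ℝ)) : eLpNorm f 1 ν ≤ C * eLpNorm f q W := by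
  let g : C_c(X, ℝ) :=
    { toFun := fun x => ‖f x‖
      continuous_toFun := f.continuous.norm
      hasCompactSupport' := f.hasCompactSupport.norm }
  have hfν : Integrable f ν := f.continuous.integrable_of_hasCompactSupport f.hasCompactSupport
  have h1 : eLpNorm f 1 ν = ENNReal.ofReal (∫ x, g x ∂ν) := by
    rw [eLpNorm_one_eq_lintegral_enorm, ← ofReal_integral_norm_eq_lintegral_enorm hfν]
    rfl
  rw [h1]
  have h2 := ENNReal.tendsto_ofReal (hν g)
  have h3 := ENNReal.Tendsto.const_mul (a := C)
    (tendsto_eLpNorm_of_tendsto_integral hVW (ENNReal.HolderConjugate.one_le q p) hq' f)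
    (Or.inr hC)
  refine le_of_tendsto_of_tendsto' h2 h3 fun i => ?_
  have h4 : ENNReal.ofReal (∫ x, g x * y i x ∂V i) ≤ eLpNorm (y i • (f : X → ℝ)) 1 (V i) := by
    rw [eLpNorm_one_eq_lintegral_enorm]
    have : ∫ x, g x * y i x ∂V i = ∫ x, ‖y i x • f x‖ ∂V i := by
      congr 1; ext x
      simp [g, abs_of_nonneg (hy0 i x), mul_comm]
    rw [this]
    refine (ENNReal.ofReal_le_ofReal (le_abs_self _)).trans ?_
    rw [← Real.norm_eq_abs, ofReal_norm]
    refine (enorm_integral_le_lintegral_enorm _).trans ?_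
    simp
  refine h4.trans ((eLpNorm_smul_le_mul_eLpNorm (p := p) (q := q)
    f.continuous.aestronglyMeasurable (hy i).aestronglyMeasurable).trans ?_)
  exact mul_le_mul_left (hyC i) _

theorem eLpNorm_one_le_of_forall_hasCompactSupport {W ν : Measure X}
    [IsFiniteMeasureOnCompacts W] [IsFiniteMeasure ν] {q C : ℝ≥0∞} (hq : 1 ≤ q) (hq' : q ≠ ⊤)
    (hC : C ≠ ⊤) (h : ∀ f : C_c(X, ℝ), eLpNorm f 1 ν ≤ C * eLpNorm f q W)
    {f : X → ℝ} (hf : MemLp f q (W + ν)) : eLpNorm f 1 ν ≤ C * eLpNorm f q W := by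
  have hWr : W.Regular := inferInstance
  have hsum' : IsFiniteMeasureOnCompacts (W + ν) :=
    ⟨fun K hK => by
      rw [Measure.add_apply]
      exact ENNReal.add_lt_top.2 ⟨hK.measure_lt_top, measure_lt_top _ _⟩⟩
  have hsum : (W + ν).Regular := inferInstance
  set c : ℝ≥0∞ := ν univ ^ (1 / (1 : ℝ≥0∞).toReal - 1 / q.toReal) with hc
  have hc' : c ≠ ⊤ := by
    refine ENNReal.rpow_ne_top_of_nonneg ?_ (measure_ne_top _ _)
    have : 1 ≤ q.toReal := by
      simpa using ENNReal.toReal_mono hq' hq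
    simp only [ENNReal.toReal_one, div_one, one_div, sub_nonneg]
    exact inv_le_one_of_one_le₀ this
  have key : ∀ ε : ℝ≥0∞, ε ≠ 0 → eLpNorm f 1 ν ≤ (c * ε + C * ε) + C * eLpNorm f q W := by
    intro ε hε
    obtain ⟨g, hgs, hg, hgc, hgm⟩ := hf.exists_hasCompactSupport_eLpNorm_sub_le hq' hε
    have hfν : AEStronglyMeasurable f ν :=
      hf.1.mono_measure (Measure.le_add_left le_rfl)
    have hfW : AEStronglyMeasurable f W :=
      hf.1.mono_measure (Measure.le_add_right le_rfl)
    have h1 : eLpNorm (f - g) q ν ≤ ε := (eLpNorm_mono_measure _ (Measure.le_add_left le_rfl)).trans hg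
    have h2 : eLpNorm (f - g) q W ≤ ε := (eLpNorm_mono_measure _ (Measure.le_add_right le_rfl)).trans hg
    have h3 : eLpNorm (f - g) 1 ν ≤ c * ε := by
      refine (eLpNorm_le_eLpNorm_mul_rpow_measure_univ hq
        (hfν.sub hgc.aestronglyMeasurable)).trans ?_
      rw [mul_comm]
      gcongr
    have h4 : eLpNorm f 1 ν ≤ eLpNorm (f - g) 1 ν + eLpNorm g 1 ν := by
      have := eLpNorm_add_le (f := f - g) (g := g) (p := 1) (μ := ν)
        (hfν.sub hgc.aestronglyMeasurable) hgc.aestronglyMeasurable le_rfl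
      simpa using this
    have h5 : eLpNorm g q W ≤ ε + eLpNorm f q W := by
      have := eLpNorm_sub_le (f := f) (g := f - g) (p := q) (μ := W) hfW
        (hfW.sub hgc.aestronglyMeasurable) hq
      rw [sub_sub_cancel] at this
      rw [add_comm]
      exact this.trans (by gcongr)
    have h6 := h ⟨⟨g, hgc⟩, hgs⟩
    calc eLpNorm f 1 ν ≤ c * ε + C * (ε + eLpNorm f q W) := by
          refine h4.trans (add_le_add h3 (le_trans h6 ?_))
          gcongr
          exact h5
      _ = _ := by ring
  have hlim : Tendsto (fun ε : ℝ≥0∞ => (c * ε + C * ε) + C * eLpNorm f q W) (𝓝[>] 0)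
      (𝓝 ((c * 0 + C * 0) + C * eLpNorm f q W)) := by
    refine Tendsto.mono_left ?_ nhdsWithin_le_nhds
    refine Tendsto.add (Tendsto.add ?_ ?_) tendsto_const_nhds
    · exact ENNReal.Tendsto.const_mul tendsto_id (Or.inr hc')
    · exact ENNReal.Tendsto.const_mul tendsto_id (Or.inr hC)
  simp only [mul_zero, add_zero, zero_add] at hlim
  refine ge_of_tendsto hlim ?_
  filter_upwards [self_mem_nhdsWithin] with ε hε
  exact key ε (ne_of_gt hε)

end WeakCompactness

section Density

open scoped NNReal

/-- A finite measure `ν` dominated on `L^q(W)` by `C` times the `L^q(W)` norm has a density in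
`L^p(W)` of norm at most `C`. -/
theorem exists_density_eLpNorm_le {X : Type*} [MeasurableSpace X] {W ν : Measure X} [SigmaFinite W]
    [IsFiniteMeasure ν] {p q C : ℝ≥0∞} [ENNReal.HolderConjugate p q] (hp : 1 < p) (hC : C ≠ ⊤)
    (h : ∀ f : X → ℝ, MemLp f q (W + ν) → eLpNorm f 1 ν ≤ C * eLpNorm f q W) :
    ∃ z : X → ℝ, Measurable z ∧ eLpNorm z p W ≤ C ∧
      ∀ f : X → ℝ, ∫ x, f x ∂ν = ∫ x, f x * z x ∂W := by
  have hq0 : q ≠ 0 := ENNReal.HolderConjugate.ne_zero q p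
  have hac : ν ≪ W := by
    refine Measure.AbsolutelyContinuous.mk fun s hs hWs => ?_
    have h1 := h (s.indicator fun _ => 1) (memLp_indicator_const q hs 1 (Or.inr (by
      rw [Measure.add_apply, hWs, zero_add]; exact measure_ne_top _ _)))
    have h2 : eLpNorm (s.indicator fun _ => (1 : ℝ)) q W = 0 := by
      rw [eLpNorm_eq_zero_iff ((measurable_const.indicator hs).aestronglyMeasurable) hq0]
      exact indicator_meas_zero hWs
    rw [h2, mul_zero, eLpNorm_indicator_const hs one_ne_zero ENNReal.one_ne_top] at h1
    simpa using h1
  let zn : X → ℝ≥0 := fun x => (ν.rnDeriv W x).toNNReal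
  have hzn : Measurable zn := (Measure.measurable_rnDeriv ν W).ennreal_toNNReal
  have hden : W.withDensity (fun x => (zn x : ℝ≥0∞)) = ν := by
    conv_rhs => rw [← Measure.withDensity_rnDeriv_eq ν W hac]
    refine withDensity_congr_ae ?_
    filter_upwards [Measure.rnDeriv_lt_top ν W] with x hx
    exact ENNReal.coe_toNNReal hx.ne
  have hznorm : ∀ x, ‖(zn x : ℝ)‖ₑ = zn x := fun x => by simp
  refine ⟨fun x => zn x, hzn.coe_nnreal_real, ?_, fun f => ?_⟩
  swap
  · conv_lhs => rw [← hden]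
    rw [integral_withDensity_eq_integral_smul hzn]
    congr 1; ext x
    rw [NNReal.smul_def, smul_eq_mul, mul_comm]
  by_cases hptop : p = ⊤
  · subst hptop
    have hq1 : q = 1 := (ENNReal.HolderConjugate.eq_top_iff_eq_one ⊤ q).1 rfl
    subst hq1
    rw [eLpNorm_exponent_top]
    refine eLpNormEssSup_le_of_ae_enorm_bound ?_
    simp_rw [hznorm]
    refine ae_le_of_forall_setLIntegral_le_of_sigmaFinite hzn.coe_nnreal_ennreal fun s hs hWs => ?_
    rw [← withDensity_apply _ hs, hden, setLIntegral_const]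
    have h1 := h (s.indicator fun _ => 1) (memLp_indicator_const 1 hs 1 (Or.inr (by
      rw [Measure.add_apply]; exact (ENNReal.add_lt_top.2 ⟨hWs, measure_lt_top _ _⟩).ne)))
    rw [eLpNorm_indicator_const hs one_ne_zero ENNReal.one_ne_top,
      eLpNorm_indicator_const hs one_ne_zero ENNReal.one_ne_top] at h1
    simpa using h1
  · have hp1 : 1 < p.toReal := by simpa using (ENNReal.toReal_lt_toReal (by simp) hptop).2 hp
    have hp0 : p ≠ 0 := (zero_lt_one.trans hp).ne'
    have hconj := ENNReal.HolderConjugate.toReal (p := p) (q := q) hp1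
    have hqtop : q ≠ ⊤ := by
      rw [Ne, ENNReal.HolderConjugate.eq_top_iff_eq_one q p]
      exact hp.ne'
    set r := p.toReal with hr
    let g : ℕ → X → ℝ := fun n => (spanningSets W n).indicator fun x => min (zn x : ℝ) n
    have hS := measurableSet_spanningSets W
    have hg : ∀ n, Measurable (g n) := fun n =>
      (hzn.coe_nnreal_real.min measurable_const).indicator (hS n)
    have hg0 : ∀ n x, 0 ≤ g n x := fun n x =>
      indicator_nonneg (fun x _ => le_min (zn x).2 (Nat.cast_nonneg n)) x
    have hgz : ∀ n x, g n x ≤ zn x := fun n x =>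
      indicator_apply_le' (fun _ => min_le_left _ _) fun _ => (zn x).2
    have hgn : ∀ n x, g n x ≤ (spanningSets W n).indicator (fun _ => (n : ℝ)) x := fun n x =>
      indicator_le_indicator (min_le_right _ _)
    have hfin : ∀ n, (W + ν) (spanningSets W n) ≠ ⊤ := fun n => by
      rw [Measure.add_apply]
      exact (ENNReal.add_lt_top.2 ⟨measure_spanningSets_lt_top W n, measure_lt_top _ _⟩).ne
    have hmem : ∀ n, MemLp (g n) p W := fun n =>
      (memLp_indicator_const p (hS n) (n : ℝ)
        (Or.inr (measure_spanningSets_lt_top W n).ne)).mono (hg n).aestronglyMeasurable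
        (Eventually.of_forall fun x => by
          rw [Real.norm_of_nonneg (hg0 n x)]
          exact (hgn n x).trans (le_abs_self _))
    have hle : ∀ n, eLpNorm (g n) p W ≤ C := by
      intro n
      have h1 := h (fun x => ‖g n x‖ ^ (r - 1)) (by
        refine (memLp_indicator_const q (hS n) ((n : ℝ) ^ (r - 1)) (Or.inr (hfin n))).mono
          ((hg n).norm.pow_const _).aestronglyMeasurable (Eventually.of_forall fun x => ?_)
        by_cases hx : x ∈ spanningSets W n
        · rw [indicator_of_mem hx]
          have := hgn n x
          rw [indicator_of_mem hx] at this
          rw [Real.norm_of_nonneg (hg0 n x), Real.norm_of_nonneg (Real.rpow_nonneg (hg0 n x) _)]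
          exact (Real.rpow_le_rpow (hg0 n x) this (by linarith)).trans (le_abs_self _)
        · have : g n x = 0 := indicator_of_notMem hx _
          rw [this, norm_zero, Real.zero_rpow (by linarith), norm_zero]
          positivity)
      rw [eLpNorm_norm_rpow (p := q) _ (by linarith)] at h1
      have hexp : q * ENNReal.ofReal (r - 1) = p := by
        rw [← ENNReal.ofReal_toReal hqtop, ← ENNReal.ofReal_toReal hptop,
          ← ENNReal.ofReal_mul ENNReal.toReal_nonneg]
        congr 1
        have h2 := hconj.sub_one_mul_conj
        rw [mul_comm]; exact h2
      rw [hexp, eLpNorm_one_eq_lintegral_enorm, ← hden,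
        lintegral_withDensity_eq_lintegral_mul _ hzn.coe_nnreal_ennreal
          ((hg n).norm.pow_const _).enorm] at h1
      have h3 : eLpNorm (g n) p W ^ r ≤
          ∫⁻ x, ((fun x => (zn x : ℝ≥0∞)) * fun x => ‖‖g n x‖ ^ (r - 1)‖ₑ) x ∂W := by
        rw [eLpNorm_eq_lintegral_rpow_enorm_toReal hp0 hptop, ← ENNReal.rpow_mul, one_div,
          inv_mul_cancel₀ (by linarith), ENNReal.rpow_one]
        refine lintegral_mono fun x => ?_
        have h4 : ‖g n x‖ₑ ^ r = ‖g n x‖ₑ * ‖‖g n x‖ ^ (r - 1)‖ₑ := by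
          rw [Real.enorm_rpow_of_nonneg (norm_nonneg _) (by linarith), enorm_norm]
          conv_rhs => rw [← ENNReal.rpow_one ‖g n x‖ₑ, ← ENNReal.rpow_mul, one_mul]
          rw [← ENNReal.rpow_add_of_nonneg _ _ zero_le_one (by linarith)]
          congr 1; ring
        change ‖g n x‖ₑ ^ r ≤ (zn x : ℝ≥0∞) * ‖‖g n x‖ ^ (r - 1)‖ₑ
        rw [h4, ← hznorm]
        gcongr
        exact enorm_le_iff_norm_le.2 (by
          rw [Real.norm_of_nonneg (hg0 n x)]; exact (hgz n x).trans (le_abs_self _))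
      have h5 := h3.trans h1
      rcases eq_or_ne (eLpNorm (g n) p W) 0 with h0 | h0
      · rw [h0]; exact zero_le
      have hft := (hmem n).eLpNorm_lt_top.ne
      have h6 : eLpNorm (g n) p W ^ r =
          eLpNorm (g n) p W * eLpNorm (g n) p W ^ (r - 1) := by
        conv_rhs => rw [← ENNReal.rpow_one (eLpNorm (g n) p W), ← ENNReal.rpow_mul, one_mul]
        rw [← ENNReal.rpow_add_of_nonneg _ _ zero_le_one (by linarith)]
        congr 1; ring
      rw [h6] at h5
      exact (ENNReal.mul_le_mul_iff_left
        (by simp only [ne_eq, ENNReal.rpow_eq_zero_iff, not_or, not_and]; exact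
              ⟨fun hh => absurd hh h0, fun hh => absurd hh hft⟩)
        (ENNReal.rpow_ne_top_of_nonneg (by linarith) hft)).1 h5
    refine (Lp.eLpNorm_lim_le_liminf_eLpNorm (f := g) (fun n => (hg n).aestronglyMeasurable)
      _ (Eventually.of_forall fun x => ?_)).trans ?_
    · refine tendsto_const_nhds.congr' ?_
      obtain ⟨N, hN⟩ := exists_nat_ge (zn x : ℝ)
      filter_upwards [eventually_ge_atTop N,
        eventually_ge_atTop (spanningSetsIndex W x)] with n hn hn'
      have : x ∈ spanningSets W n :=
        monotone_spanningSets W hn' (mem_spanningSetsIndex W x)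
      simp only [g, indicator_of_mem this]
      rw [min_eq_left]
      exact hN.trans (by exact_mod_cast hn)
    · exact (liminf_le_liminf (Eventually.of_forall hle)).trans (by simp)

end Density

section VagueLimit

open scoped NNReal

variable {X : Type*} [TopologicalSpace X] [T2Space X] [LocallyCompactSpace X]
  [SecondCountableTopology X] [MeasurableSpace X] [BorelSpace X]

theorem exists_measure_le_of_tendsto_integral {V : ℕ → Measure X} {W : Measure X}
    [∀ i, IsFiniteMeasureOnCompacts (V i)]
    (hVW : ∀ f : C_c(X, ℝ), Tendsto (fun i => ∫ x, f x ∂V i) atTop (𝓝 (∫ x, f x ∂W)))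
    {K : Set X} (hK : IsCompact K) : ∃ B : ℝ≥0, ∀ i, V i K ≤ B := by
  obtain ⟨f, hf1, -, hfc, hf01⟩ := exists_continuous_one_zero_of_isCompact hK
    (isClosed_empty (X := X)) (disjoint_empty K)
  let g : C_c(X, ℝ) := ⟨f, hfc⟩
  obtain ⟨B, hB⟩ := (hVW g).bddAbove_range
  refine ⟨B.toNNReal, fun i => ?_⟩
  have h1 : V i K ≤ ENNReal.ofReal (∫ x, g x ∂V i) := by
    rw [ofReal_integral_eq_lintegral_ofReal (f := g)
      (g.continuous.integrable_of_hasCompactSupport g.hasCompactSupport)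
      (Eventually.of_forall fun x => (hf01 x).1), ← lintegral_indicator_one hK.measurableSet]
    refine lintegral_mono fun x => ?_
    by_cases hx : x ∈ K
    · have : g x = 1 := hf1 hx
      simp [hx, this]
    · simp [hx]
  exact h1.trans (ENNReal.ofReal_le_ofReal (hB ⟨i, rfl⟩))

theorem exists_subseq_tendsto_of_nonneg {V : ℕ → Measure X} {W : Measure X}
    [∀ i, IsFiniteMeasureOnCompacts (V i)] [IsFiniteMeasureOnCompacts W]
    (hVW : ∀ f : C_c(X, ℝ), Tendsto (fun i => ∫ x, f x ∂V i) atTop (𝓝 (∫ x, f x ∂W)))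
    {p : ℝ≥0∞} (hp : 1 < p) {κ : Type*} [Countable κ] (y : κ → ℕ → X → ℝ≥0)
    (hy : ∀ k i, Measurable (y k i)) (K : κ → Set X) (hK : ∀ k, IsCompact (K k))
    (hyK : ∀ k i, ∀ x ∉ K k, y k i x = 0) (C : κ → ℝ≥0)
    (hyC : ∀ k i, eLpNorm (fun x => (y k i x : ℝ)) p (V i) ≤ C k) :
    ∃ φ : ℕ → ℕ, StrictMono φ ∧ ∃ z : κ → X → ℝ, ∀ k, Measurable (z k) ∧ MemLp (z k) p W ∧
      ∀ f : C_c(X, ℝ), Tendsto (fun j => ∫ x, f x * y k (φ j) x ∂V (φ j)) atTop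
        (𝓝 (∫ x, f x * z k x ∂W)) := by
  obtain ⟨q, hconj⟩ : ∃ q, ENNReal.HolderConjugate p q :=
    ⟨_, ENNReal.HolderConjugate.conjExponent hp.le⟩
  have hqtop : q ≠ ⊤ := by
    rw [Ne, ENNReal.HolderConjugate.eq_top_iff_eq_one q p]
    exact hp.ne'
  have hq1 : 1 ≤ q := ENNReal.HolderConjugate.one_le q p
  let ν : κ → ℕ → Measure X := fun k i => (V i).withDensity fun x => (y k i x : ℝ≥0∞)
  choose B hB using fun k => exists_measure_le_of_tendsto_integral hVW (hK k)
  let c : ℝ := 1 / (1 : ℝ≥0∞).toReal - 1 / p.toReal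
  have hc : 0 ≤ c := by
    rcases eq_or_ne p ⊤ with rfl | hpt
    · simp [c]
    · have : 1 ≤ p.toReal := by simpa using ENNReal.toReal_mono hpt hp.le
      simp only [c, ENNReal.toReal_one, div_one, one_div, sub_nonneg]
      exact inv_le_one_of_one_le₀ this
  have hmass : ∀ k i, ν k i univ ≤ ((C k * B k ^ c : ℝ≥0) : ℝ≥0∞) := by
    intro k i
    have h1 : ν k i univ = eLpNorm (fun x => (y k i x : ℝ)) 1 ((V i).restrict (K k)) := by
      rw [withDensity_apply _ MeasurableSet.univ, Measure.restrict_univ,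
        eLpNorm_one_eq_lintegral_enorm, ← lintegral_indicator (hK k).measurableSet]
      refine lintegral_congr fun x => ?_
      by_cases hx : x ∈ K k
      · simp [hx]
      · simp [hx, hyK k i x hx]
    rw [h1]
    refine (eLpNorm_le_eLpNorm_mul_rpow_measure_univ hp.le
      (hy k i).coe_nnreal_real.aestronglyMeasurable).trans ?_
    rw [ENNReal.coe_mul, ENNReal.coe_rpow_of_nonneg _ hc, Measure.restrict_apply_univ]
    gcongr
    · exact (eLpNorm_mono_measure _ Measure.restrict_le_self).trans (hyC k i)
    · exact hB k i
  have hfin : ∀ k i, IsFiniteMeasure (ν k i) := fun k i =>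
    ⟨(hmass k i).trans_lt ENNReal.coe_lt_top⟩
  have hint : ∀ k i (f : X → ℝ), ∫ x, f x ∂ν k i = ∫ x, f x * y k i x ∂V i := fun k i f => by
    rw [integral_withDensity_eq_integral_smul (hy k i)]
    congr 1; ext x
    rw [NNReal.smul_def, smul_eq_mul, mul_comm]
  obtain ⟨νF, hνF⟩ : ∃ νF : κ → ℕ → FiniteMeasure X, ∀ k i, (νF k i : Measure X) = ν k i :=
    ⟨fun k i => ⟨ν k i, hfin k i⟩, fun _ _ => rfl⟩
  obtain ⟨φ, hφ, μ, hμ⟩ := exists_subseq_tendsto_integral νF K hK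
    (fun k => C k * B k ^ c) (fun k i => by
      rw [← ENNReal.coe_le_coe, FiniteMeasure.ennreal_mass, hνF]
      exact hmass k i) (fun k i => by
      rw [FiniteMeasure.null_iff_toMeasure_null, hνF,
        withDensity_apply _ (hK k).measurableSet.compl,
        setLIntegral_congr_fun (hK k).measurableSet.compl (g := fun _ => 0)
          (fun x hx => by simp [hyK k i x hx])]
      simp)
  have hlim : ∀ k (f : C_c(X, ℝ)), Tendsto (fun j => ∫ x, f x * y k (φ j) x ∂V (φ j)) atTop
      (𝓝 (∫ x, f x ∂(μ k : Measure X))) := fun k f => by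
    have := hμ k f.toBoundedContinuousFunction
    refine this.congr fun j => ?_
    rw [hνF]
    exact hint k (φ j) f
  have hz : ∀ k, ∃ z : X → ℝ, Measurable z ∧ eLpNorm z p W ≤ C k ∧
      ∀ f : X → ℝ, ∫ x, f x ∂(μ k : Measure X) = ∫ x, f x * z x ∂W := by
    intro k
    refine exists_density_eLpNorm_le (q := q) hp ENNReal.coe_ne_top fun f hf => ?_
    refine eLpNorm_one_le_of_forall_hasCompactSupport hq1 hqtop ENNReal.coe_ne_top
      (fun f => ?_) hf
    exact eLpNorm_one_le_of_tendsto (V := fun j => V (φ j))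
      (fun f => (hVW f).comp hφ.tendsto_atTop) (p := p) hqtop
      (y := fun j x => (y k (φ j) x : ℝ)) (fun j => (hy k (φ j)).coe_nnreal_real)
      (fun j x => (y k (φ j) x).2) ENNReal.coe_ne_top (fun j => hyC k (φ j)) (hlim k) f
  choose z hzm hzp hzint using hz
  refine ⟨φ, hφ, z, fun k => ⟨hzm k, ⟨(hzm k).aestronglyMeasurable,
    (hzp k).trans_lt ENNReal.coe_lt_top⟩, fun f => ?_⟩⟩
  rw [← hzint k]
  exact hlim k f

/-- Weak compactness of densities: if `V i` converges vaguely to `W` and `y k i` is bounded in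
`L^p(V i)` and supported in a fixed compact set for each of countably many `k`, then along a
subsequence `y k i • V i` converges vaguely to `z k • W` with `z k` in `L^p(W)`. -/
theorem exists_subseq_tendsto_integral_mul {V : ℕ → Measure X} {W : Measure X}
    [∀ i, IsFiniteMeasureOnCompacts (V i)] [IsFiniteMeasureOnCompacts W]
    (hVW : ∀ f : C_c(X, ℝ), Tendsto (fun i => ∫ x, f x ∂V i) atTop (𝓝 (∫ x, f x ∂W)))
    {p : ℝ≥0∞} (hp : 1 < p) {κ : Type*} [Countable κ] (y : κ → ℕ → X → ℝ)
    (hy : ∀ k i, Measurable (y k i)) (K : κ → Set X) (hK : ∀ k, IsCompact (K k))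
    (hyK : ∀ k i, ∀ x ∉ K k, y k i x = 0) (C : κ → ℝ≥0)
    (hyC : ∀ k i, eLpNorm (y k i) p (V i) ≤ C k) :
    ∃ φ : ℕ → ℕ, StrictMono φ ∧ ∃ z : κ → X → ℝ, ∀ k, Measurable (z k) ∧ MemLp (z k) p W ∧
      ∀ f : C_c(X, ℝ), Tendsto (fun j => ∫ x, f x * y k (φ j) x ∂V (φ j)) atTop
        (𝓝 (∫ x, f x * z k x ∂W)) := by
  have hbd : ∀ k i (s : ℝ), |s| = 1 →
      eLpNorm (fun x => ((s * y k i x).toNNReal : ℝ)) p (V i) ≤ C k := fun k i s hs => by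
    refine (eLpNorm_mono fun x => ?_).trans (hyC k i)
    rw [Real.coe_toNNReal', Real.norm_of_nonneg (le_max_right _ _), Real.norm_eq_abs]
    exact max_le ((le_abs_self _).trans (by rw [abs_mul, hs, one_mul])) (abs_nonneg _)
  let sgn : Bool → ℝ := fun b => if b then 1 else -1
  have hsgn : ∀ b, |sgn b| = 1 := by rintro (_ | _) <;> simp [sgn]
  obtain ⟨φ, hφ, z, hz⟩ := exists_subseq_tendsto_of_nonneg hVW hp
    (κ := κ × Bool) (fun k i x => (sgn k.2 * y k.1 i x).toNNReal)
    (fun k i => ((hy k.1 i).const_mul _).real_toNNReal) (fun k => K k.1) (fun k => hK k.1)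
    (fun k i x hx => by simp [hyK k.1 i x hx]) (fun k => C k.1)
    (fun k i => hbd k.1 i _ (hsgn k.2))
  refine ⟨φ, hφ, fun k x => z (k, true) x - z (k, false) x, fun k =>
    ⟨(hz (k, true)).1.sub (hz (k, false)).1, (hz (k, true)).2.1.sub (hz (k, false)).2.1,
      fun f => ?_⟩⟩
  obtain ⟨q, hconj⟩ : ∃ q, ENNReal.HolderConjugate p q :=
    ⟨_, ENNReal.HolderConjugate.conjExponent hp.le⟩
  have hint : ∀ {μ : Measure X} [IsFiniteMeasureOnCompacts μ] {g : X → ℝ}, MemLp g p μ →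
      Integrable (fun x => f x * g x) μ := fun {μ} _ {g} hg => by
    have hf : MemLp f q μ := f.continuous.memLp_of_hasCompactSupport f.hasCompactSupport
    rw [← memLp_one_iff_integrable]
    have := MemLp.mul (r := 1) hg hf
    exact this
  have h1 := ((hz (k, true)).2.2 f).sub ((hz (k, false)).2.2 f)
  rw [← integral_sub (hint (hz (k, true)).2.1) (hint (hz (k, false)).2.1)] at h1
  have h2 : (fun j => ∫ x, f x * y k (φ j) x ∂V (φ j)) = fun j =>
      ∫ x, f x * ((sgn true * y k (φ j) x).toNNReal : ℝ) ∂V (φ j) -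
        ∫ x, f x * ((sgn false * y k (φ j) x).toNNReal : ℝ) ∂V (φ j) := by
    ext j
    rw [← integral_sub]
    · congr 1; ext x
      rw [← mul_sub]
      congr 1
      rcases le_total 0 (y k (φ j) x) with h0 | h0 <;> simp [sgn, h0]
    all_goals
      refine hint ⟨((hy k _).const_mul _).real_toNNReal.coe_nnreal_real.aestronglyMeasurable,
        (hbd k _ _ (hsgn _)).trans_lt ENNReal.coe_lt_top⟩
  rw [h2]
  simpa only [mul_sub] using h1

end VagueLimit

section Section

variable {X : Type*} [TopologicalSpace X] [T2Space X] [LocallyCompactSpace X]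
  [SecondCountableTopology X] [MeasurableSpace X] [BorelSpace X]

theorem measurableSet_image_of_continuous_injOn {B : Type*} [TopologicalSpace B] [T2Space B]
    [MeasurableSpace B] [BorelSpace B] {pr : X → B} (hpr : Continuous pr) {s : Set X}
    (hs : MeasurableSet s) (hinj : InjOn pr s) : MeasurableSet (pr '' s) := by
  have h1 : pr '' s = ⋃ n, (fun x : compactCovering X n => pr x) '' (Subtype.val ⁻¹' s) := by
    ext b
    simp only [mem_image, mem_iUnion, mem_preimage, Subtype.exists, exists_and_left, exists_prop]
    constructor
    · rintro ⟨x, hx, rfl⟩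
      obtain ⟨n, hn⟩ := mem_iUnion.1 ((iUnion_compactCovering X).symm ▸ mem_univ x)
      exact ⟨n, x, hx, hn, rfl⟩
    · rintro ⟨n, x, hx, -, rfl⟩
      exact ⟨x, hx, rfl⟩
  rw [h1]
  refine MeasurableSet.iUnion fun n => ?_
  have : CompactSpace (compactCovering X n) :=
    isCompact_iff_compactSpace.1 (isCompact_compactCovering X n)
  have : PolishSpace (compactCovering X n) := by
    let _ := TopologicalSpace.metrizableSpaceMetric (compactCovering X n)
    infer_instance
  exact (measurable_subtype_coe hs).image_of_continuousOn_injOn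
    (hpr.comp continuous_subtype_val).continuousOn
    fun x hx y hy hxy => Subtype.ext (hinj hx hy hxy)

/-- If `pr` is injective on a conull set `A`, then every measurable function on `X` descends along
`pr` to a measurable function, outside of a null set. -/
theorem exists_measurableSet_descend {B : Type*} [TopologicalSpace B] [T2Space B]
    [MeasurableSpace B] [BorelSpace B] {pr : X → B} (hpr : Continuous pr) (W : Measure X) {A : Set X}
    (hA : ∀ᵐ q ∂W, q ∈ A) (hinj : InjOn pr A) :
    ∃ S ⊆ A, MeasurableSet S ∧ W Sᶜ = 0 ∧ MeasurableSet (pr '' S) ∧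
      ∀ g : X → ℝ, Measurable g → ∃ h : B → ℝ, Measurable h ∧ ∀ q ∈ S, h (pr q) = g q := by
  let S : Set X := (toMeasurable W Aᶜ)ᶜ
  have hSA : S ⊆ A := by
    rw [← compl_compl A]
    exact compl_subset_compl.2 (subset_toMeasurable W Aᶜ)
  have hS : MeasurableSet S := (measurableSet_toMeasurable W Aᶜ).compl
  refine ⟨S, hSA, hS, ?_, measurableSet_image_of_continuous_injOn hpr hS (hinj.mono hSA),
    fun g hg => ?_⟩
  · rw [compl_compl, measure_toMeasurable]
    exact hA
  · have hemb : MeasurableEmbedding fun q : S => pr q :=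
      { injective := fun q r hqr => Subtype.ext (hinj (hSA q.2) (hSA r.2) hqr)
        measurable := hpr.measurable.comp measurable_subtype_coe
        measurableSet_image' := fun t ht => by
          have : (fun q : S => pr q) '' t = pr '' (Subtype.val '' t) := by
            rw [image_image]
          rw [this]
          refine measurableSet_image_of_continuous_injOn hpr
            ((MeasurableEmbedding.subtype_coe hS).measurableSet_image' ht) (hinj.mono ?_)
          rintro _ ⟨q, -, rfl⟩
          exact hSA q.2 }
    obtain ⟨h, hh, hgh⟩ := hemb.exists_measurable_extend (hg.comp measurable_subtype_coe)
      (fun _ => ⟨(0 : ℝ)⟩)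
    exact ⟨h, hh, fun q hq => congrFun hgh ⟨q, hq⟩⟩

/-- A locally integrable function which integrates to zero against all compactly supported
continuous functions vanishes almost everywhere. -/
theorem ae_eq_zero_of_forall_integral_mul_compactlySupported {W : Measure X} {g : X → ℝ}
    (hg : LocallyIntegrable g W) (h : ∀ f : C_c(X, ℝ), ∫ x, f x * g x ∂W = 0) : g =ᵐ[W] 0 := by
  refine ae_eq_zero_of_forall_setIntegral_isCompact_eq_zero' hg fun s hs => ?_
  obtain ⟨χ, hχ1, -, hχc, hχ01⟩ := exists_continuous_one_zero_of_isCompact hs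
    (isClosed_empty (X := X)) (disjoint_empty s)
  let f : ℕ → C_c(X, ℝ) := fun n =>
    { toFun := fun x => χ x * (hs.isClosed.apprSeq n x : ℝ)
      continuous_toFun := χ.continuous.mul
        (NNReal.continuous_coe.comp (hs.isClosed.apprSeq n).continuous)
      hasCompactSupport' := hχc.mul_right }
  have hL : Tendsto (fun n => ∫ x, f n x * g x ∂W) atTop (𝓝 (∫ x in s, g x ∂W)) := by
    rw [← integral_indicator hs.measurableSet]
    refine tendsto_integral_of_dominated_convergence (fun x => ‖χ x * g x‖)
      (fun n => (f n).continuous.aestronglyMeasurable.mul hg.aestronglyMeasurable) ?_ ?_ ?_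
    · exact (hg.integrable_smul_left_of_hasCompactSupport χ.continuous hχc).norm
    · refine fun n => Eventually.of_forall fun x => ?_
      change ‖χ x * (hs.isClosed.apprSeq n x : ℝ) * g x‖ ≤ _
      rw [mul_right_comm, norm_mul]
      refine mul_le_of_le_one_right (norm_nonneg _) ?_
      rw [Real.norm_of_nonneg (NNReal.coe_nonneg _)]
      exact_mod_cast HasOuterApproxClosed.apprSeq_apply_le_one hs.isClosed n x
    · refine Eventually.of_forall fun x => ?_
      have h1 := (tendsto_pi_nhds.1 (HasOuterApproxClosed.tendsto_apprSeq hs.isClosed)) x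
      have h2 := ((NNReal.tendsto_coe.2 h1).const_mul (χ x)).mul_const (g x)
      have h3 : s.indicator g x = χ x * ((s.indicator (fun _ => (1 : NNReal)) x : NNReal) : ℝ) * g x := by
        by_cases hx : x ∈ s
        · have : χ x = 1 := hχ1 hx
          simp [hx, this]
        · simp [hx]
      rw [h3]
      exact h2
  simp_rw [h] at hL
  exact (tendsto_nhds_unique hL tendsto_const_nhds)

end Section

section TangentPlane

theorem setIntegral_submodule_hausdorffMeasure_pos {E : Type*} [NormedAddCommGroup E]
    [NormedSpace ℝ E] [FiniteDimensional ℝ E] [MeasurableSpace E] [BorelSpace E]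
    (P : Submodule ℝ E) (f : C_c(E, ℝ)) (hf : ∀ v, 0 ≤ f v) {v : E} (hv : v ∈ P) (hfv : f v ≠ 0) :
    0 < ∫ v in (P : Set E), f v ∂μH[(Module.finrank ℝ P : ℝ)] := by
  have hiso : Isometry (Subtype.val : P → E) := isometry_subtype_coe
  have hmap := hiso.map_hausdorffMeasure (d := (Module.finrank ℝ P : ℝ)) (Or.inl (by positivity))
  rw [Subtype.range_coe] at hmap
  have hcl : Topology.IsClosedEmbedding (Subtype.val : P → E) :=
    P.closed_of_finiteDimensional.isClosedEmbedding_subtypeVal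
  have h1 : ∫ v in (P : Set E), f v ∂μH[(Module.finrank ℝ P : ℝ)] =
      ∫ v : P, f v ∂μH[(Module.finrank ℝ P : ℝ)] := by
    rw [← hcl.measurableEmbedding.integral_map, hmap]
  rw [h1]
  exact (f.continuous.comp continuous_subtype_val).integral_pos_of_hasCompactSupport_nonneg_nonzero
    (f.hasCompactSupport.comp_isClosedEmbedding hcl) (fun v => hf v) (x := ⟨v, hv⟩) hfv

variable {E : Type*} [NormedAddCommGroup E] [NormedSpace ℝ E] [FiniteDimensional ℝ E]
  [MeasurableSpace E] [BorelSpace E]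
  {H : Type*} [TopologicalSpace H] {I : ModelWithCorners ℝ E H} {m : ℕ}
  {U : Type*} [TopologicalSpace U] [ChartedSpace H U] [MeasurableSpace U]

theorem IsApproxTangentPlane.le {M : Measure U} {x : U} {P Q : Submodule ℝ (TangentSpace I x)}
    (hP : IsApproxTangentPlane I m M x P) (hQ : IsApproxTangentPlane I m M x Q) : P ≤ Q := by
  obtain ⟨hPm, θ, hθ, hlimP⟩ := hP
  obtain ⟨-, θ', -, hlimQ⟩ := hQ
  let P' : Submodule ℝ E := P
  let Q' : Submodule ℝ E := Q
  have hPm' : Module.finrank ℝ P' = m := hPm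
  intro v hv
  by_contra hvQ
  have hvQ' : v ∈ (Q' : Set E)ᶜ := hvQ
  obtain ⟨f, hf1, hf0, hfc, hf01⟩ := exists_continuous_one_zero_of_isCompact
    (X := E) (isCompact_singleton (x := (show E from v))) Q'.closed_of_finiteDimensional
    (disjoint_singleton_left.2 hvQ')
  let g : C_c(E, ℝ) := ⟨f, hfc⟩
  have h1 := tendsto_nhds_unique (hlimP g) (hlimQ g)
  have h2 : ∫ v in {v : E | (show TangentSpace I x from v) ∈ Q}, g v ∂μH[(m : ℝ)] = 0 :=
    setIntegral_eq_zero_of_forall_eq_zero fun w hw => hf0 hw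
  have h3 : 0 < ∫ v in {v : E | (show TangentSpace I x from v) ∈ P}, g v ∂μH[(m : ℝ)] := by
    have := setIntegral_submodule_hausdorffMeasure_pos P' g (fun v => (hf01 v).1) (v := v) hv
      (by
        have : g v = 1 := hf1 rfl
        rw [this]; exact one_ne_zero)
    rwa [hPm'] at this
  rw [h2, mul_zero] at h1
  exact (mul_pos hθ h3).ne' h1

theorem IsApproxTangentPlane.eq_approxTan {M : Measure U} {x : U}
    {P : Submodule ℝ (TangentSpace I x)} (hP : IsApproxTangentPlane I m M x P) :
    approxTan I m M x = P := by
  have h : ∃ P, IsApproxTangentPlane I m M x P := ⟨P, hP⟩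
  rw [approxTan, dif_pos h]
  exact le_antisymm (h.choose_spec.le hP) (hP.le h.choose_spec)

end TangentPlane

section FiberBundleTopology

variable {B F : Type*} [TopologicalSpace B] [TopologicalSpace F] (E : B → Type*)
  [TopologicalSpace (TotalSpace F E)] [∀ b, TopologicalSpace (E b)] [FiberBundle F E]

variable (F) in
theorem FiberBundle.t2Space_totalSpace [T2Space B] [T2Space F] : T2Space (TotalSpace F E) := by
  refine ⟨fun p q hpq => ?_⟩
  by_cases hb : p.proj = q.proj
  · let e := trivializationAt F E p.proj
    have : T2Space e.source := T2Space.of_injective_continuous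
      (f := fun r : e.source => e r) (fun r s hrs => Subtype.ext (e.injOn r.2 s.2 hrs))
      e.continuousOn.domRestrict
    have hp : p ∈ e.source := FiberBundle.mem_trivializationAt_proj_source
    have hq : q ∈ e.source := by
      rw [e.mem_source, ← hb]
      exact FiberBundle.mem_baseSet_trivializationAt' p.proj
    exact separated_by_isOpenEmbedding e.open_source.isOpenEmbedding_subtypeVal
      (x := ⟨p, hp⟩) (y := ⟨q, hq⟩) (fun h => hpq (congrArg Subtype.val h))
  · exact separated_by_continuous (FiberBundle.continuous_proj F E) hb

variable (F) in
theorem FiberBundle.secondCountableTopology_totalSpace [SecondCountableTopology B]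
    [SecondCountableTopology F] : SecondCountableTopology (TotalSpace F E) := by
  obtain ⟨s, hs, hcov⟩ := TopologicalSpace.countable_cover_nhds
    (f := fun b : B => (trivializationAt F E b).baseSet)
    fun b => (trivializationAt F E b).open_baseSet.mem_nhds
      (FiberBundle.mem_baseSet_trivializationAt' b)
  have := hs.to_subtype
  have : ∀ b : s, SecondCountableTopology (trivializationAt F E b.1).source := fun b =>
    (trivializationAt F E b.1).toHomeomorphSourceTarget.isInducing.secondCountableTopology
  refine TopologicalSpace.secondCountableTopology_of_countable_cover
    (U := fun b : s => (trivializationAt F E b.1).source) (fun b => (trivializationAt F E b.1).open_source) ?_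
  refine eq_univ_of_forall fun p => ?_
  have : p.proj ∈ ⋃ b ∈ s, (trivializationAt F E b).baseSet := hcov ▸ mem_univ _
  simp only [mem_iUnion] at this ⊢
  obtain ⟨b, hb, hp⟩ := this
  exact ⟨⟨b, hb⟩, (Trivialization.mem_source _).2 hp⟩

end FiberBundleTopology

section GrassmannTopology

variable {E : Type*} [NormedAddCommGroup E] [NormedSpace ℝ E] [FiniteDimensional ℝ E]
  {H : Type*} [TopologicalSpace H] {I : ModelWithCorners ℝ E H} {m : ℕ}
  {U : Type*} [TopologicalSpace U] [ChartedSpace H U] [IsManifold I 1 U]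
  [RiemannianBundle (fun x : U => TangentSpace I x)]

namespace GrassmannBundle

theorem proj_injective : Function.Injective (proj : GrassmannBundle I m U → _) := by
  rintro ⟨x, P, hP⟩ ⟨y, Q, hQ⟩ h
  obtain rfl : x = y := congrArg TotalSpace.proj h
  have h1 : P.starProjection = Q.starProjection := eq_of_heq (TotalSpace.mk.inj h).2
  obtain rfl : P = Q := by
    rw [← Submodule.range_starProjection P, h1, Submodule.range_starProjection]
  rfl

theorem isEmbedding_proj : Topology.IsEmbedding (proj : GrassmannBundle I m U → _) :=
  ⟨⟨rfl⟩, proj_injective⟩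

instance t2Space [T2Space U] : T2Space (GrassmannBundle I m U) :=
  have := FiberBundle.t2Space_totalSpace (E →L[ℝ] E)
    (fun x : U => TangentSpace I x →L[ℝ] TangentSpace I x)
  isEmbedding_proj.t2Space

instance secondCountableTopology [SecondCountableTopology U] :
    SecondCountableTopology (GrassmannBundle I m U) :=
  have := FiberBundle.secondCountableTopology_totalSpace (E →L[ℝ] E)
    (fun x : U => TangentSpace I x →L[ℝ] TangentSpace I x)
  isEmbedding_proj.secondCountableTopology

/-- A self-adjoint idempotent of trace `m` on a fibre is the projection onto an `m`-plane. -/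
theorem exists_proj_eq {x : U} (T : TangentSpace I x →L[ℝ] TangentSpace I x)
    (hid : T ∘L T = T) (hsymm : ∀ v w, inner ℝ (T v) w = inner ℝ v (T w))
    (htr : LinearMap.trace ℝ (TangentSpace I x) (T : TangentSpace I x →ₗ[ℝ] TangentSpace I x) = m) :
    ∃ q : GrassmannBundle I m U, proj q = ⟨x, T⟩ := by
  have h1 : (T : TangentSpace I x →ₗ[ℝ] TangentSpace I x).IsSymmetricProjection :=
    { isIdempotentElem := by
        ext v
        exact congrArg (fun S : TangentSpace I x →L[ℝ] TangentSpace I x => S v) hid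
      isSymmetric := hsymm }
  obtain ⟨_, h2⟩ := LinearMap.isSymmetricProjection_iff_eq_coe_starProjection_range.1 h1
  have h3 : T = (T : TangentSpace I x →ₗ[ℝ] TangentSpace I x).range.starProjection :=
    ContinuousLinearMap.coe_injective h2
  refine ⟨⟨x, (T : TangentSpace I x →ₗ[ℝ] TangentSpace I x).range, ?_⟩, ?_⟩
  · have h4 := (LinearMap.IsIdempotentElem.isProj_range _ h1.isIdempotentElem).trace
    rw [htr] at h4
    exact_mod_cast h4.symm
  · rw [proj]
    congr 1
    exact h3.symm

end GrassmannBundle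

end GrassmannTopology

section GrassmannProper

variable {E : Type*} [NormedAddCommGroup E] [NormedSpace ℝ E] [FiniteDimensional ℝ E]
  {H : Type*} [TopologicalSpace H] {I : ModelWithCorners ℝ E H} {m : ℕ}
  {U : Type*} [TopologicalSpace U] [ChartedSpace H U] [IsManifold I 1 U]
  [RiemannianBundle (fun x : U => TangentSpace I x)]
  [IsContinuousRiemannianBundle E (fun x : U => TangentSpace I x)]

namespace GrassmannBundle

theorem exists_isCompact_preimage_pt [LocallyCompactSpace U] [T2Space U] (x₀ : U) :
    ∃ N ∈ 𝓝 x₀, IsCompact (pt ⁻¹' N : Set (GrassmannBundle I m U)) := by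
  let e := trivializationAt E (fun x : U => TangentSpace I x) x₀
  obtain ⟨C₁, hC₁, h₁⟩ := eventually_norm_trivializationAt_lt E (fun x : U => TangentSpace I x) x₀
  obtain ⟨C₂, hC₂, h₂⟩ :=
    eventually_norm_symmL_trivializationAt_lt E (fun x : U => TangentSpace I x) x₀
  have hbase : e.baseSet ∈ 𝓝 x₀ :=
    e.open_baseSet.mem_nhds (FiberBundle.mem_baseSet_trivializationAt' x₀)
  obtain ⟨N, hN, hNsub, hNc⟩ := local_compact_nhds (inter_mem hbase (inter_mem h₁ h₂))
  refine ⟨N, hN, ?_⟩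
  have hNb : ∀ x ∈ N, x ∈ e.baseSet := fun x hx => (hNsub hx).1
  let σ : U × (E →L[ℝ] E) →
      TotalSpace (E →L[ℝ] E) (fun x : U => TangentSpace I x →L[ℝ] TangentSpace I x) := fun p =>
    ⟨p.1, (e.symmL ℝ p.1) ∘L p.2 ∘L (e.continuousLinearMapAt ℝ p.1)⟩
  have hσ : ContinuousOn σ (e.baseSet ×ˢ univ) := by
    have := (trivializationAt (E →L[ℝ] E) (fun x : U => TangentSpace I x →L[ℝ] TangentSpace I x)
      x₀).toOpenPartialHomeomorph.continuousOn_symm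
    refine this.mono ?_
    rintro ⟨x, A⟩ ⟨hx, -⟩
    exact ⟨⟨hx, hx⟩, mem_univ _⟩
  let K : Set (U × (E →L[ℝ] E)) := N ×ˢ Metric.closedBall 0 (C₁ * C₂)
  have hK : IsCompact K := hNc.prod (isCompact_closedBall _ _)
  let D : E → E → U × (E →L[ℝ] E) → ℝ := fun v w p =>
    (inner ℝ (e.symm p.1 (p.2 v)) (e.symm p.1 w) : ℝ) -
      inner ℝ (e.symm p.1 v) (e.symm p.1 (p.2 w))
  have hsec : ∀ f : U × (E →L[ℝ] E) → E, Continuous f →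
      ContinuousOn (fun p => (⟨p.1, e.symm p.1 (f p)⟩ : TangentBundle I U)) K := fun f hf =>
    e.continuousOn_symm.comp (continuous_fst.prodMk hf).continuousOn
      fun p hp => ⟨hNb p.1 hp.1, mem_univ _⟩
  have hD : ∀ v w, ContinuousOn (D v w) K := fun v w =>
    ((hsec (fun p => p.2 v) (by fun_prop)).inner_bundle (hsec (fun _ => w) (by fun_prop))).sub
      ((hsec (fun _ => v) (by fun_prop)).inner_bundle (hsec (fun p => p.2 w) (by fun_prop)))
  let Q : Set (U × (E →L[ℝ] E)) := (K ∩ {p | p.2 ∘L p.2 = p.2}) ∩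
    ({p | LinearMap.trace ℝ E (p.2 : E →ₗ[ℝ] E) = m} ∩ ⋂ v : E, ⋂ w : E, K ∩ D v w ⁻¹' {0})
  have hQ : IsCompact Q := by
    refine (hK.inter_right (isClosed_eq ?_ continuous_snd)).inter_right (IsClosed.inter ?_ ?_)
    · exact continuous_snd.clm_comp continuous_snd
    · refine isClosed_eq ?_ continuous_const
      have : Continuous fun A : E →L[ℝ] E => LinearMap.trace ℝ E (A : E →ₗ[ℝ] E) :=
        ((LinearMap.trace ℝ E).comp
          (ContinuousLinearMap.coeLM ℝ : (E →L[ℝ] E) →ₗ[ℝ] _)).continuous_of_finiteDimensional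
      exact this.comp continuous_snd
    · exact isClosed_iInter fun v => isClosed_iInter fun w =>
        (hD v w).preimage_isClosed_of_isClosed hK.isClosed isClosed_singleton
  have himage : proj '' (pt ⁻¹' N : Set (GrassmannBundle I m U)) = σ '' Q := by
    apply Subset.antisymm
    · rintro _ ⟨q, hq, rfl⟩
      have hb := hNb q.pt hq
      have hl : ∀ v, e.symmL ℝ q.pt (e.continuousLinearMapAt ℝ q.pt v) = v := fun v =>
        e.symmL_continuousLinearMapAt hb v
      have hr : ∀ v, e.continuousLinearMapAt ℝ q.pt (e.symmL ℝ q.pt v) = v := fun v =>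
        e.continuousLinearMapAt_symmL hb v
      let A : E →L[ℝ] E :=
        (e.continuousLinearMapAt ℝ q.pt) ∘L q.plane.starProjection ∘L (e.symmL ℝ q.pt)
      have hAK : (q.pt, A) ∈ K := by
        refine ⟨hq, ?_⟩
        rw [mem_closedBall_zero_iff]
        have h3 := (hNsub hq).2
        calc ‖A‖ ≤ ‖e.continuousLinearMapAt ℝ q.pt‖ *
              (‖q.plane.starProjection‖ * ‖e.symmL ℝ q.pt‖) :=
              (ContinuousLinearMap.opNorm_comp_le _ _).trans (by
                gcongr
                exact ContinuousLinearMap.opNorm_comp_le _ _)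
          _ ≤ C₁ * (1 * C₂) := by
              gcongr
              · exact h3.1.le
              · exact q.plane.starProjection_norm_le
              · exact h3.2.le
          _ = C₁ * C₂ := by ring
      refine ⟨(q.pt, A), ⟨⟨hAK, ?_⟩, ?_, ?_⟩, ?_⟩
      · ext v
        have := q.plane.isIdempotentElem_starProjection
        simp only [A, ContinuousLinearMap.comp_apply, hl]
        congr 1
        exact congrArg (fun T : TangentSpace I q.pt →L[ℝ] TangentSpace I q.pt =>
          T (e.symmL ℝ q.pt v)) this
      · let L : TangentSpace I q.pt ≃ₗ[ℝ] E := (e.continuousLinearEquivAt ℝ q.pt hb).toLinearEquiv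
        have h4 : (A : E →ₗ[ℝ] E) = L.conj
            (q.plane.starProjection : TangentSpace I q.pt →ₗ[ℝ] TangentSpace I q.pt) := by
          ext v
          rw [LinearEquiv.conj_apply_apply]
          have h5 : L.symm v = e.symmL ℝ q.pt v :=
            congrFun (e.symm_continuousLinearEquivAt_eq (R := ℝ) hb) v
          have h6 : ∀ w, L w = e.continuousLinearMapAt ℝ q.pt w := fun w =>
            congrFun (e.coe_continuousLinearEquivAt_eq (R := ℝ) hb) w
          rw [h5, h6]
          rfl
        change LinearMap.trace ℝ E (A : E →ₗ[ℝ] E) = m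
        rw [h4, LinearMap.trace_conj']
        have h7 : LinearMap.IsProj q.plane
            (q.plane.starProjection : TangentSpace I q.pt →ₗ[ℝ] TangentSpace I q.pt) :=
          ⟨fun v => q.plane.starProjection_apply_mem v,
            fun v hv => Submodule.starProjection_eq_self_iff.2 hv⟩
        rw [h7.trace, q.finrank_plane]
      · refine mem_iInter.2 fun v => mem_iInter.2 fun w => ⟨hAK, ?_⟩
        change (inner ℝ (e.symm q.pt (A v)) (e.symm q.pt w) : ℝ) -
          inner ℝ (e.symm q.pt v) (e.symm q.pt (A w)) = 0
        simp only [← e.symmL_apply (R := ℝ) hb]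
        simp only [A, ContinuousLinearMap.comp_apply, hl]
        rw [Submodule.inner_starProjection_left_eq_right, sub_self]
      · simp only [σ, A, proj]
        congr 1
        ext v
        simp only [ContinuousLinearMap.comp_apply, hl]
    · rintro _ ⟨⟨x, A⟩, ⟨⟨hAK, hid⟩, htr, hsy⟩, rfl⟩
      have hx : x ∈ N := hAK.1
      have hb := hNb x hx
      have hl : ∀ v, e.symmL ℝ x (e.continuousLinearMapAt ℝ x v) = v := fun v =>
        e.symmL_continuousLinearMapAt hb v
      have hr : ∀ v, e.continuousLinearMapAt ℝ x (e.symmL ℝ x v) = v := fun v =>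
        e.continuousLinearMapAt_symmL hb v
      let T : TangentSpace I x →L[ℝ] TangentSpace I x :=
        (e.symmL ℝ x) ∘L A ∘L (e.continuousLinearMapAt ℝ x)
      obtain ⟨q, hq⟩ := exists_proj_eq (I := I) (m := m) T
        (by
          ext v
          simp only [T, ContinuousLinearMap.comp_apply, hr]
          congr 1
          exact congrArg (fun S : E →L[ℝ] E => S (e.continuousLinearMapAt ℝ x v)) hid)
        (fun v w => by
          have h1 := (mem_iInter.1 (mem_iInter.1 hsy (e.continuousLinearMapAt ℝ x v))
            (e.continuousLinearMapAt ℝ x w)).2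
          have h2 := sub_eq_zero.1 h1
          simp only [← e.symmL_apply (R := ℝ) hb] at h2
          rw [hl, hl] at h2
          exact h2)
        (by
          let L : TangentSpace I x ≃ₗ[ℝ] E := (e.continuousLinearEquivAt ℝ x hb).toLinearEquiv
          have h4 : (T : TangentSpace I x →ₗ[ℝ] TangentSpace I x) =
              L.symm.conj (A : E →ₗ[ℝ] E) := by
            ext v
            rw [LinearEquiv.conj_apply_apply]
            have h5 : ∀ v, L.symm v = e.symmL ℝ x v := fun v =>
              congrFun (e.symm_continuousLinearEquivAt_eq (R := ℝ) hb) v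
            have h6 : ∀ w, L w = e.continuousLinearMapAt ℝ x w := fun w =>
              congrFun (e.coe_continuousLinearEquivAt_eq (R := ℝ) hb) w
            rw [h5, LinearEquiv.symm_symm, h6]
            rfl
          rw [h4, LinearMap.trace_conj']
          exact htr)
      refine ⟨q, ?_, hq⟩
      have : q.pt = x := congrArg TotalSpace.proj hq
      rw [mem_preimage, this]
      exact hx
  rw [isEmbedding_proj.isInducing.isCompact_iff, himage]
  exact hQ.image_of_continuousOn (hσ.mono fun p hp => ⟨hNb p.1 hp.1.1.1, mem_univ _⟩)

theorem isCompact_preimage_pt [LocallyCompactSpace U] [T2Space U] {K : Set U} (hK : IsCompact K) :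
    IsCompact (pt ⁻¹' K : Set (GrassmannBundle I m U)) := by
  choose N hN hNc using exists_isCompact_preimage_pt (I := I) (m := m) (U := U)
  obtain ⟨t, -, ht⟩ := hK.elim_nhds_subcover N fun x _ => hN x
  refine (t.isCompact_biUnion fun x _ => hNc x).of_isClosed_subset
    (hK.isClosed.preimage continuous_pt) fun q hq => ?_
  simpa using ht hq

instance locallyCompactSpace [LocallyCompactSpace U] [T2Space U] :
    LocallyCompactSpace (GrassmannBundle I m U) := by
  have : WeaklyLocallyCompactSpace (GrassmannBundle I m U) := ⟨fun q => by
    obtain ⟨N, hN, hNc⟩ := exists_isCompact_preimage_pt (I := I) (m := m) q.pt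
    exact ⟨_, hNc, continuous_pt.continuousAt.preimage_mem_nhds hN⟩⟩
  infer_instance

end GrassmannBundle

end GrassmannProper

section TangentFrame

open scoped NNReal

/-- A locally finite family of continuous vectorfields `field j` with compact supports, together
with Borel coordinate forms `coord j` such that `v = ∑ j, coord j x v • field j x`. -/
structure TangentFrame {E : Type*} [NormedAddCommGroup E] [NormedSpace ℝ E]
    [FiniteDimensional ℝ E] {H : Type*} [TopologicalSpace H] (I : ModelWithCorners ℝ E H)
    (U : Type*) [TopologicalSpace U] [ChartedSpace H U] [IsManifold I 1 U] [MeasurableSpace U]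
    [RiemannianBundle (fun x : U => TangentSpace I x)] (J : Type*) where
  /-- the vectorfields -/
  field : J → ∀ x : U, TangentSpace I x
  /-- the coordinate forms -/
  coord : J → ∀ x : U, TangentSpace I x →ₗ[ℝ] ℝ
  /-- the compact sets carrying the vectorfields and the coordinate forms -/
  carrier : J → Set U
  /-- the bounds on the coordinate forms -/
  bound : J → ℝ≥0
  continuous_field : ∀ j, Continuous fun x => (⟨x, field j x⟩ : TangentBundle I U)
  isCompact_carrier : ∀ j, IsCompact (carrier j)
  field_eq_zero : ∀ j, ∀ x ∉ carrier j, field j x = 0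
  coord_eq_zero : ∀ j, ∀ x ∉ carrier j, coord j x = 0
  abs_coord_le : ∀ j x v, |coord j x v| ≤ bound j * ‖v‖
  measurable_coord : ∀ j (Y : ∀ x : U, TangentSpace I x), IsBorelField I Y →
    Measurable fun x => coord j x (Y x)
  exists_finset : ∀ K : Set U, IsCompact K → ∃ F : Finset J, ∀ x ∈ K,
    (∀ j ∉ F, field j x = 0) ∧ ∀ v, ∑ j ∈ F, coord j x v • field j x = v

variable {E : Type*} [NormedAddCommGroup E] [NormedSpace ℝ E] [FiniteDimensional ℝ E]
  {H : Type*} [TopologicalSpace H] (I : ModelWithCorners ℝ E H)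
  (U : Type*) [TopologicalSpace U] [ChartedSpace H U] [IsManifold I 1 U]
  [MeasurableSpace U] [BorelSpace U]
  [RiemannianBundle (fun x : U => TangentSpace I x)]
  [IsContinuousRiemannianBundle E (fun x : U => TangentSpace I x)]

theorem exists_tangentFrame [LocallyCompactSpace U] [T2Space U] [SecondCountableTopology U] :
    ∃ t : Set U, t.Countable ∧ Nonempty (TangentFrame I U (t × Fin (Module.finrank ℝ E))) := by
  let e : ∀ x₀ : U, Trivialization E (TotalSpace.proj : TangentBundle I U → U) := fun x₀ =>
    trivializationAt E (fun x : U => TangentSpace I x) x₀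
  have hloc : ∀ x₀ : U, ∃ N ∈ 𝓝 x₀, IsCompact N ∧ N ⊆ (e x₀).baseSet ∧ ∃ C : ℝ≥0, ∀ x ∈ N,
      ‖(e x₀).continuousLinearMapAt ℝ x‖ ≤ C := by
    intro x₀
    obtain ⟨C, hC, h⟩ := eventually_norm_trivializationAt_lt E (fun x : U => TangentSpace I x) x₀
    obtain ⟨N, hN, hNsub, hNc⟩ := local_compact_nhds (inter_mem ((e x₀).open_baseSet.mem_nhds
      (FiberBundle.mem_baseSet_trivializationAt' x₀)) h)
    exact ⟨N, hN, hNc, fun x hx => (hNsub hx).1, ⟨C, hC.le⟩, fun x hx => (hNsub hx).2.le⟩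
  choose N hN hNc hNb C hC using hloc
  obtain ⟨t, ht, hcov⟩ := TopologicalSpace.countable_cover_nhds
    (f := fun b : U => interior (N b)) fun b => interior_mem_nhds.2 (hN b)
  obtain ⟨ρ, hρ⟩ := PartitionOfUnity.exists_isSubordinate (isClosed_univ (X := U))
    (fun b : t => interior (N b)) (fun b => isOpen_interior) (by
      rw [← hcov, biUnion_eq_iUnion])
  let B := Module.finBasis ℝ E
  have hcoord : ∀ a, ∃ c : ℝ≥0, ∀ w : E, |B.coord a w| ≤ c * ‖w‖ := fun a => by
    let l := LinearMap.toContinuousLinearMap (B.coord a)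
    exact ⟨‖l‖₊, fun w => l.le_opNorm w⟩
  choose c hc using hcoord
  have hsupp : ∀ (b : t) (x : U), ρ b x ≠ 0 → x ∈ N b := fun b x hx =>
    interior_subset (hρ b (subset_tsupport _ hx))
  classical
  refine ⟨t, ht, ⟨
    { field := fun j x => (e j.1).symmL ℝ x (ρ j.1 x • B j.2)
      coord := fun j x => if x ∈ N j.1 then
        (B.coord j.2) ∘ₗ ((e j.1).continuousLinearMapAt ℝ x : TangentSpace I x →ₗ[ℝ] E) else 0
      carrier := fun j => N j.1
      bound := fun j => c j.2 * C j.1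
      continuous_field := ?_
      isCompact_carrier := fun j => hNc _
      field_eq_zero := fun j x hx => by
        have : ρ j.1 x = 0 := by
          by_contra h
          exact hx (hsupp _ x h)
        simp only [this, zero_smul, map_zero]
      coord_eq_zero := fun j x hx => if_neg hx
      abs_coord_le := ?_
      measurable_coord := ?_
      exists_finset := ?_ }⟩⟩
  · rintro ⟨b, a⟩
    rw [continuous_iff_continuousAt]
    intro x
    by_cases hx : x ∈ tsupport (ρ b)
    · have hxb : (e b).baseSet ∈ 𝓝 x := (e b).open_baseSet.mem_nhds
        (hNb b (interior_subset (hρ b hx)))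
      have h1 : ContinuousOn (fun x => (⟨x, (e b).symm x (ρ b x • B a)⟩ : TangentBundle I U))
          (e b).baseSet :=
        (e b).continuousOn_symm.comp
          (continuous_id.prodMk ((ρ b).continuous.smul continuous_const)).continuousOn
          fun y hy => ⟨hy, mem_univ _⟩
      refine (h1.continuousAt hxb).congr ?_
      filter_upwards [hxb] with y hy
      rw [← (e b).symmL_apply (R := ℝ) hy]
    · have h2 : ContinuousAt (Bundle.zeroSection E (TangentSpace I : U → Type _)) x :=
        (Bundle.contMDiff_zeroSection ℝ (TangentSpace I : U → Type _) (IB := I) (n := 0)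
          ).continuous.continuousAt
      refine h2.congr ?_
      filter_upwards [(isClosed_tsupport (ρ b)).isOpen_compl.mem_nhds hx] with y hy
      have : ρ b y = 0 := image_eq_zero_of_notMem_tsupport hy
      simp only [this, zero_smul, map_zero]
      rfl
  · rintro ⟨b, a⟩ x v
    by_cases hx : x ∈ N b
    · simp only [if_pos hx]
      refine (hc a _).trans ?_
      rw [NNReal.coe_mul, mul_assoc]
      gcongr
      exact ((e b).continuousLinearMapAt ℝ x).le_of_opNorm_le (hC b x hx) v
    · simp only [if_neg hx, LinearMap.zero_apply, abs_zero]
      positivity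
  · rintro ⟨b, a⟩ Y hY
    let _ : MeasurableSpace (TangentBundle I U) := borel _
    have : BorelSpace (TangentBundle I U) := ⟨rfl⟩
    have hs : MeasurableSet ((TotalSpace.proj : TangentBundle I U → U) ⁻¹' N b) :=
      ((hNc b).isClosed.preimage (FiberBundle.continuous_proj E _)).measurableSet
    let l := LinearMap.toContinuousLinearMap (B.coord a)
    have h1 : ContinuousOn (fun p : TangentBundle I U => l (e b p).2)
        ((TotalSpace.proj : TangentBundle I U → U) ⁻¹' N b) :=
      l.continuous.comp_continuousOn ((e b).continuousOn.snd.mono fun p hp =>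
        (e b).mem_source.2 (hNb b hp))
    have h2 := (h1.measurable_piecewise (continuousOn_const (c := (0 : ℝ))) hs).comp
      (show Measurable (fun x => (⟨x, Y x⟩ : TangentBundle I U)) from hY)
    convert h2 using 1
    ext x
    by_cases hx : x ∈ N b
    · simp only [if_pos hx, Function.comp_apply]
      rw [piecewise_eq_of_mem (TotalSpace.proj ⁻¹' N b) _ _
        (show (⟨x, Y x⟩ : TangentBundle I U) ∈ _ from hx)]
      change B.coord a ((e b).continuousLinearMapAt ℝ x (Y x)) = B.coord a (e b ⟨x, Y x⟩).2
      exact congrArg (B.coord a)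
        (congrFun ((e b).coe_linearMapAt_of_mem (R := ℝ) (hNb b hx)) (Y x))
    · simp only [if_neg hx, Function.comp_apply]
      rw [piecewise_eq_of_notMem (TotalSpace.proj ⁻¹' N b) _ _
        (show (⟨x, Y x⟩ : TangentBundle I U) ∉ _ from hx)]
      rfl
  · intro K hK
    have hfin := ρ.locallyFinite.finite_nonempty_inter_compact hK
    have hout : ∀ x ∈ K, ∀ b ∉ hfin.toFinset, ρ b x = 0 := fun x hx b hb => by
      by_contra h
      exact hb (hfin.mem_toFinset.2 ⟨x, h, hx⟩)
    refine ⟨hfin.toFinset ×ˢ Finset.univ, fun x hx => ⟨?_, fun v => ?_⟩⟩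
    · rintro ⟨b, a⟩ hj
      have hb : b ∉ hfin.toFinset := fun hb => hj (Finset.mk_mem_product hb (Finset.mem_univ a))
      simp only [hout x hx b hb, zero_smul, map_zero]
    · rw [Finset.sum_product]
      have h1 : ∀ b : t, (∑ a, (if x ∈ N b then
          (B.coord a) ∘ₗ ((e b).continuousLinearMapAt ℝ x : TangentSpace I x →ₗ[ℝ] E) else 0) v •
          (e b).symmL ℝ x (ρ b x • B a)) = ρ b x • v := by
        intro b
        by_cases hb : ρ b x = 0
        · simp [hb]
        · have hxN := hsupp b x hb
          simp only [if_pos hxN, map_smul, smul_comm _ (ρ b x), ← Finset.smul_sum]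
          congr 1
          have h3 : ∑ a, B.coord a ((e b).continuousLinearMapAt ℝ x v) • B a =
              (e b).continuousLinearMapAt ℝ x v := B.sum_repr _
          have h4 := congrArg ((e b).symmL ℝ x) h3
          rw [map_sum, (e b).symmL_continuousLinearMapAt (hNb b hxN)] at h4
          simp only [map_smul] at h4
          exact h4
      refine (Finset.sum_congr rfl fun b _ => h1 b).trans ?_
      rw [← Finset.sum_smul]
      have h5 := ρ.sum_eq_one (mem_univ x)
      rw [finsum_eq_sum_of_support_subset (s := hfin.toFinset) _ (fun b hb => by
        by_contra h
        exact hb (hout x hx b h))] at h5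
      rw [h5, one_smul]

end TangentFrame

section Pairing

open scoped NNReal

variable {E : Type*} [NormedAddCommGroup E] [NormedSpace ℝ E] [FiniteDimensional ℝ E]
  {H : Type*} [TopologicalSpace H] {I : ModelWithCorners ℝ E H} {m : ℕ}
  {U : Type*} [TopologicalSpace U] [ChartedSpace H U] [IsManifold I 1 U]

theorem TangentBundle.continuous_sum_smul {M ι : Type*} [TopologicalSpace M] {b : M → U}
    (hb : Continuous b) (F : Finset ι) {c : ι → M → ℝ} (hc : ∀ i, Continuous (c i))
    {v : ι → ∀ x : M, TangentSpace I (b x)}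
    (hv : ∀ i, Continuous fun x => (⟨b x, v i x⟩ : TangentBundle I U)) :
    Continuous fun x => (⟨b x, ∑ i ∈ F, c i x • v i x⟩ : TangentBundle I U) := by
  rw [continuous_iff_continuousAt]
  intro x₀
  rw [FiberBundle.continuousAt_totalSpace]
  refine ⟨hb.continuousAt, ?_⟩
  let e := trivializationAt E (TangentSpace I : U → Type _) (b x₀)
  have hbase : ∀ᶠ x in 𝓝 x₀, b x ∈ e.baseSet := hb.continuousAt.eventually_mem
    (e.open_baseSet.mem_nhds (FiberBundle.mem_baseSet_trivializationAt' (b x₀)))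
  have h1 : ContinuousAt (fun x => ∑ i ∈ F, c i x •
      (e (⟨b x, v i x⟩ : TangentBundle I U)).2) x₀ :=
    tendsto_finsetSum _ fun i _ => (hc i).continuousAt.smul
      (((FiberBundle.continuousAt_totalSpace _ _).1 (hv i).continuousAt).2)
  refine h1.congr ?_
  filter_upwards [hbase] with x hx
  have h2 : ∀ w : TangentSpace I (b x), (e (⟨b x, w⟩ : TangentBundle I U)).2 =
      e.linearMapAt ℝ (b x) w := fun w =>
    (congrFun (e.coe_linearMapAt_of_mem (R := ℝ) hx) w).symm
  change _ = (e (⟨b x, ∑ i ∈ F, c i x • v i x⟩ : TangentBundle I U)).2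
  rw [h2, map_sum]
  simp only [h2, map_smul]

section Tangent

variable [MeasurableSpace E] [BorelSpace E] [MeasurableSpace U]
  [RiemannianBundle (fun x : U => TangentSpace I x)]

theorem GrassmannBundle.injOn_pt (M : Measure U) :
    InjOn pt {q : GrassmannBundle I m U | IsApproxTangentPlane I m M q.pt q.plane} := by
  rintro ⟨x, P, hP⟩ h1 ⟨y, Q, hQ⟩ h2 (rfl : x = y)
  obtain rfl : P = Q := (IsApproxTangentPlane.eq_approxTan h1).symm.trans h2.eq_approxTan
  rfl

theorem evalTan_pt (X : ∀ q : GrassmannBundle I m U, TangentSpace I q.pt) {M : Measure U}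
    {q : GrassmannBundle I m U} (hq : IsApproxTangentPlane I m M q.pt q.plane) :
    evalTan I X M q.pt = X q := by
  obtain ⟨x, P, hP⟩ := q
  obtain rfl : approxTan I m M x = P := hq.eq_approxTan
  exact dif_pos hP

end Tangent

variable [MeasurableSpace U] [BorelSpace U] [RiemannianBundle (fun x : U => TangentSpace I x)]

theorem varifoldWeight_compl_image_pt {V : Measure (GrassmannBundle I m U)}
    {S : Set (GrassmannBundle I m U)} (hS : V Sᶜ = 0)
    (hm : MeasurableSet (GrassmannBundle.pt '' S)) :
    varifoldWeight V (GrassmannBundle.pt '' S)ᶜ = 0 := by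
  rw [varifoldWeight, Measure.map_apply GrassmannBundle.measurable_pt hm.compl]
  exact measure_mono_null (fun q hq hqS => hq (mem_image_of_mem _ hqS)) hS

namespace TangentFrame

variable {J : Type*} (B : TangentFrame I U J)

theorem eLpNorm_coord_le {Y : ∀ x : U, TangentSpace I x} (hY : IsBorelField I Y) {p : ℝ≥0∞}
    [T2Space U] (V : Measure (GrassmannBundle I m U)) (j : J) :
    eLpNorm (fun q : GrassmannBundle I m U => B.coord j q.pt (Y q.pt)) p V ≤
      B.bound j * lpNormOn I Y p (varifoldWeight V) (B.carrier j) := by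
  have h1 : eLpNorm (fun q : GrassmannBundle I m U => B.coord j q.pt (Y q.pt)) p V =
      eLpNorm (fun x => B.coord j x (Y x)) p (varifoldWeight V) :=
    (eLpNorm_map_measure (B.measurable_coord j Y hY).aestronglyMeasurable
      GrassmannBundle.measurable_pt.aemeasurable).symm
  have h2 : (fun x => B.coord j x (Y x)) =
      (B.carrier j).indicator fun x => B.coord j x (Y x) := by
    refine (indicator_eq_self.2 fun x hx => ?_).symm
    by_contra h
    exact hx (by simp only [B.coord_eq_zero j x h, LinearMap.zero_apply])
  rw [h1, h2, eLpNorm_indicator_eq_eLpNorm_restrict (B.isCompact_carrier j).measurableSet, lpNormOn]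
  exact eLpNorm_le_nnreal_smul_eLpNorm_of_ae_le_mul
    (ae_of_all _ fun x => by
      rw [← NNReal.coe_le_coe]
      simpa using B.abs_coord_le j x (Y x)) p

variable [IsContinuousRiemannianBundle E (fun x : U => TangentSpace I x)]

theorem exists_inner_eq_sum [T2Space U]
    {X : ∀ q : GrassmannBundle I m U, TangentSpace I q.pt} (hX : IsTestField I X) :
    ∃ (F : Finset J) (g : J → C_c(GrassmannBundle I m U, ℝ)),
      (∀ q v, inner ℝ (X q) v = ∑ j ∈ F, g j q * B.coord j q.pt v) ∧
      ∀ q (c : J → ℝ), inner ℝ (X q) (∑ᶠ j, c j • B.field j q.pt) = ∑ j ∈ F, g j q * c j := by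
  obtain ⟨hXc, K, hK, hXK⟩ := hX
  obtain ⟨F, hF⟩ := B.exists_finset (GrassmannBundle.pt '' K)
    (hK.image GrassmannBundle.continuous_pt)
  refine ⟨F, fun j => ⟨⟨fun q => inner ℝ (X q) (B.field j q.pt), ?_⟩, ?_⟩, fun q v => ?_,
    fun q c => ?_⟩
  · exact hXc.inner_bundle ((B.continuous_field j).comp GrassmannBundle.continuous_pt)
  · exact HasCompactSupport.intro hK fun q hq => by
      change inner ℝ (X q) (B.field j q.pt) = (0 : ℝ)
      rw [hXK q hq, inner_zero_left]
  · by_cases hq : q ∈ K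
    · conv_lhs => rw [← (hF q.pt (mem_image_of_mem _ hq)).2 v, inner_sum]
      simp only [inner_smul_right]
      exact Finset.sum_congr rfl fun j _ => mul_comm _ _
    · change _ = ∑ j ∈ F, inner ℝ (X q) (B.field j q.pt) * _
      simp [hXK q hq]
  · change _ = ∑ j ∈ F, inner ℝ (X q) (B.field j q.pt) * _
    by_cases hq : q ∈ K
    · rw [finsum_eq_sum_of_support_subset (s := F) _ fun j hj => by
        by_contra h
        exact hj (by simp only [(hF q.pt (mem_image_of_mem _ hq)).1 j h, smul_zero]), inner_sum]
      simp only [inner_smul_right]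
      exact Finset.sum_congr rfl fun j _ => mul_comm _ _
    · simp [hXK q hq]

end TangentFrame

end Pairing

theorem CompactlySupportedContinuousMap.integrable_mul_memLp {X : Type*} [TopologicalSpace X]
    [MeasurableSpace X] [OpensMeasurableSpace X] [SecondCountableTopologyEither X ℝ]
    {μ : Measure X} [IsFiniteMeasureOnCompacts μ] (f : C_c(X, ℝ)) {p : ℝ≥0∞} (hp : 1 ≤ p)
    {g : X → ℝ} (hg : MemLp g p μ) : Integrable (fun x => f x * g x) μ := by
  obtain ⟨q, hconj⟩ : ∃ q, ENNReal.HolderConjugate p q :=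
    ⟨_, ENNReal.HolderConjugate.conjExponent hp⟩
  have hf : MemLp f q μ := f.continuous.memLp_of_hasCompactSupport f.hasCompactSupport
  rw [← memLp_one_iff_integrable]
  have := MemLp.mul (r := 1) hg hf
  exact this

section Limit

variable {E : Type*} [NormedAddCommGroup E] [NormedSpace ℝ E] [FiniteDimensional ℝ E]
  [MeasurableSpace E] [BorelSpace E]
  {H : Type*} [TopologicalSpace H] {I : ModelWithCorners ℝ E H} {m : ℕ}
  {U : Type*} [TopologicalSpace U] [T2Space U] [LocallyCompactSpace U] [SecondCountableTopology U]
  [ChartedSpace H U] [IsManifold I 1 U]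
  [MeasurableSpace U] [BorelSpace U] [RiemannianBundle (fun x : U => TangentSpace I x)]
  [IsContinuousRiemannianBundle E (fun x : U => TangentSpace I x)]

namespace TangentFrame

variable {J : Type*} (B : TangentFrame I U J)

theorem tanPairing_eq_integral (B : TangentFrame I U J) {V : Measure (GrassmannBundle I m U)}
    (hV : ∀ᵐ q ∂V, IsApproxTangentPlane I m (varifoldWeight V) q.pt q.plane)
    {X : ∀ q : GrassmannBundle I m U, TangentSpace I q.pt} (hX : IsTestField I X)
    {Y : ∀ x : U, TangentSpace I x} (hY : IsBorelField I Y) :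
    tanPairing X Y (varifoldWeight V) = ∫ q, inner ℝ (X q) (Y q.pt) ∂V := by
  obtain ⟨F, g, hg, -⟩ := B.exists_inner_eq_sum hX
  obtain ⟨S, hSA, -, hS0, hSm, hS⟩ := exists_measurableSet_descend GrassmannBundle.continuous_pt V
    hV (GrassmannBundle.injOn_pt (varifoldWeight V))
  have hmeas : Measurable fun q : GrassmannBundle I m U => (inner ℝ (X q) (Y q.pt) : ℝ) := by
    simp only [hg]
    exact Finset.measurable_fun_sum _ fun j _ => (g j).continuous.measurable.mul
      ((B.measurable_coord j Y hY).comp GrassmannBundle.measurable_pt)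
  obtain ⟨h, hh, hhS⟩ := hS _ hmeas
  have h1 : tanPairing X Y (varifoldWeight V) = ∫ x, h x ∂varifoldWeight V := by
    refine integral_congr_ae ?_
    have := mem_ae_iff.2 (varifoldWeight_compl_image_pt hS0 hSm)
    filter_upwards [this]
    rintro _ ⟨q, hq, rfl⟩
    change inner ℝ (evalTan I X (varifoldWeight V) q.pt) (Y q.pt) = h q.pt
    rw [evalTan_pt X (hSA hq), hhS q hq]
  rw [h1, varifoldWeight, integral_map GrassmannBundle.measurable_pt.aemeasurable
    hh.aestronglyMeasurable]
  refine integral_congr_ae ?_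
  filter_upwards [mem_ae_iff.2 hS0] with q hq using hhS q hq

theorem memLp_coord {Y : ∀ x : U, TangentSpace I x} {p : ℝ≥0∞}
    {V : Measure (GrassmannBundle I m U)} (hY : IsBorelField I Y)
    (hYp : ∀ K, IsCompact K → lpNormOn I Y p (varifoldWeight V) K < ⊤) (j : J) :
    MemLp (fun q : GrassmannBundle I m U => B.coord j q.pt (Y q.pt)) p V :=
  ⟨((B.measurable_coord j Y hY).comp GrassmannBundle.measurable_pt).aestronglyMeasurable,
    (B.eLpNorm_coord_le hY V j).trans_lt
      (ENNReal.mul_lt_top ENNReal.coe_lt_top (hYp _ (B.isCompact_carrier j)))⟩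

theorem isBorelField_finsum [Countable J] {h : J → U → ℝ} (hh : ∀ j, Measurable (h j)) :
    IsBorelField I (fun x => ∑ᶠ j, h j x • B.field j x) := by
  let _ : MeasurableSpace (TangentBundle I U) := borel _
  have : BorelSpace (TangentBundle I U) := ⟨rfl⟩
  choose F hF using fun n => B.exists_finset _ (isCompact_compactCovering U n)
  have hcont : ∀ n, Continuous fun a : U × (J → ℝ) =>
      (⟨a.1, ∑ j ∈ F n, a.2 j • B.field j a.1⟩ : TangentBundle I U) := fun n =>
    TangentBundle.continuous_sum_smul continuous_fst (F n)
      (c := fun j (a : U × (J → ℝ)) => a.2 j) (fun j => by fun_prop)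
      (v := fun j (a : U × (J → ℝ)) => B.field j a.1)
      fun j => (B.continuous_field j).comp continuous_fst
  have hmeas : ∀ n, Measurable fun x =>
      (⟨x, ∑ j ∈ F n, h j x • B.field j x⟩ : TangentBundle I U) := fun n =>
    (hcont n).measurable.comp (g := fun a : U × (J → ℝ) =>
      (⟨a.1, ∑ j ∈ F n, a.2 j • B.field j a.1⟩ : TangentBundle I U))
      (measurable_id.prodMk (measurable_pi_lambda _ hh))
  have heq : ∀ n, ∀ x ∈ compactCovering U n,
      ∑ᶠ j, h j x • B.field j x = ∑ j ∈ F n, h j x • B.field j x := fun n x hx =>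
    finsum_eq_sum_of_support_subset _ fun j hj => by
      by_contra hjF
      exact hj (by simp only [(hF n x hx).1 j hjF, smul_zero])
  intro s hs
  have : (fun x => (⟨x, ∑ᶠ j, h j x • B.field j x⟩ : TangentBundle I U)) ⁻¹' s =
      ⋃ n, compactCovering U n ∩
        (fun x => (⟨x, ∑ j ∈ F n, h j x • B.field j x⟩ : TangentBundle I U)) ⁻¹' s := by
    ext x
    simp only [mem_iUnion, mem_inter_iff, mem_preimage]
    constructor
    · intro hx
      obtain ⟨n, hn⟩ := mem_iUnion.1 ((iUnion_compactCovering U).symm ▸ mem_univ x)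
      exact ⟨n, hn, heq n x hn ▸ hx⟩
    · rintro ⟨n, hn, hx⟩
      exact (heq n x hn).symm ▸ hx
  rw [this]
  exact MeasurableSet.iUnion fun n =>
    (isCompact_compactCovering U n).measurableSet.inter (hmeas n hs)

theorem exists_norm_field_le {K : Set U} (hK : IsCompact K) (j : J) :
    ∃ C : ℝ, ∀ x ∈ K, ‖B.field j x‖ ≤ C := by
  have h1 : Continuous fun x => (inner ℝ (B.field j x) (B.field j x) : ℝ) :=
    (B.continuous_field j).inner_bundle (B.continuous_field j)
  obtain ⟨C, hC⟩ := hK.bddAbove_image h1.continuousOn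
  refine ⟨√C, fun x hx => Real.le_sqrt_of_sq_le ?_⟩
  rw [← real_inner_self_eq_norm_sq]
  exact hC (mem_image_of_mem _ hx)

theorem memLpLocField_finsum [Countable J] {h : J → U → ℝ} {p : ℝ≥0∞} {M : Measure U}
    (hh : ∀ j, Measurable (h j)) (hp : ∀ j, MemLp (h j) p M) :
    MemLpLocField I (fun x => ∑ᶠ j, h j x • B.field j x) p M := by
  refine ⟨B.isBorelField_finsum hh, fun K hK => ?_⟩
  obtain ⟨F, hF⟩ := B.exists_finset K hK
  choose C hC using fun j => B.exists_norm_field_le hK j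
  have h1 : MemLp (fun x => ∑ j ∈ F, C j * ‖h j x‖) p (M.restrict K) :=
    memLp_finsetSum F fun j _ => ((hp j).restrict K).norm.const_mul (C j)
  refine lt_of_le_of_lt (eLpNorm_mono_ae ?_) h1.2
  filter_upwards [ae_restrict_mem hK.measurableSet] with x hx
  rw [norm_norm, finsum_eq_sum_of_support_subset (s := F) _ fun j hj => by
    by_contra hjF
    exact hj (by simp only [(hF x hx).1 j hjF, smul_zero])]
  refine (norm_sum_le _ _).trans ((Finset.sum_le_sum fun j _ => ?_).trans (le_abs_self _))
  rw [norm_smul, mul_comm]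
  exact mul_le_mul_of_nonneg_right (hC j x hx) (norm_nonneg _)

/-- Fields with bounded `L^p` norms on compact sets subconverge, as densities of rectifiable
varifolds. -/
theorem exists_subseq_tendsto_tanPairing (B : TangentFrame I U J) [Countable J] {p : ℝ≥0∞} (hp : 1 < p)
    {V : ℕ → Measure (GrassmannBundle I m U)} {W : Measure (GrassmannBundle I m U)}
    [∀ i, IsFiniteMeasureOnCompacts (V i)] [IsFiniteMeasureOnCompacts W]
    (hV : ∀ i, ∀ᵐ q ∂V i, IsApproxTangentPlane I m (varifoldWeight (V i)) q.pt q.plane)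
    (hW : ∀ᵐ q ∂W, IsApproxTangentPlane I m (varifoldWeight W) q.pt q.plane)
    (hVW : VarifoldTendsto V W)
    {Y : ℕ → ∀ x : U, TangentSpace I x} (hY : ∀ i, IsBorelField I (Y i))
    (hbound : ∀ K : Set U, IsCompact K → (⨆ i, lpNormOn I (Y i) p (varifoldWeight (V i)) K) < ⊤) :
    ∃ φ : ℕ → ℕ, StrictMono φ ∧ ∃ Z : ∀ x : U, TangentSpace I x,
      MemLpLocField I Z p (varifoldWeight W) ∧
      ∀ X : ∀ q : GrassmannBundle I m U, TangentSpace I q.pt, IsTestField I X →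
        Tendsto (fun j => tanPairing X (Y (φ j)) (varifoldWeight (V (φ j)))) atTop
          (𝓝 (tanPairing X Z (varifoldWeight W))) := by
  obtain ⟨φ, hφ, z, hz⟩ := exists_subseq_tendsto_integral_mul hVW hp
    (fun j i (q : GrassmannBundle I m U) => B.coord j q.pt (Y i q.pt))
    (fun j i => (B.measurable_coord j (Y i) (hY i)).comp GrassmannBundle.measurable_pt)
    (fun j => GrassmannBundle.pt ⁻¹' B.carrier j)
    (fun j => GrassmannBundle.isCompact_preimage_pt (B.isCompact_carrier j))
    (fun j i q hq => by
      simp only [B.coord_eq_zero j q.pt hq, LinearMap.zero_apply])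
    (fun j => B.bound j *
      (⨆ i, lpNormOn I (Y i) p (varifoldWeight (V i)) (B.carrier j)).toNNReal)
    (fun j i => (B.eLpNorm_coord_le (hY i) (V i) j).trans (by
      rw [ENNReal.coe_mul, ENNReal.coe_toNNReal (hbound _ (B.isCompact_carrier j)).ne]
      gcongr
      exact le_iSup (fun i => lpNormOn I (Y i) p (varifoldWeight (V i)) (B.carrier j)) i))
  obtain ⟨S, -, -, hS0, -, hS⟩ := exists_measurableSet_descend GrassmannBundle.continuous_pt W
    hW (GrassmannBundle.injOn_pt (varifoldWeight W))
  choose h hh hhz using fun j => hS (z j) (hz j).1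
  have hae : ∀ j, (h j ∘ GrassmannBundle.pt) =ᵐ[W] z j := fun j => by
    filter_upwards [mem_ae_iff.2 hS0] with q hq using hhz j q hq
  have hZ : MemLpLocField I (fun x => ∑ᶠ j, h j x • B.field j x) p (varifoldWeight W) :=
    B.memLpLocField_finsum hh fun j =>
      (memLp_map_measure_iff (hh j).aestronglyMeasurable
        GrassmannBundle.measurable_pt.aemeasurable).2 ((memLp_congr_ae (hae j)).2 (hz j).2.1)
  refine ⟨φ, hφ, _, hZ, fun X hX => ?_⟩
  obtain ⟨F, g, hg, hgZ⟩ := B.exists_inner_eq_sum hX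
  have h1 : ∀ i, tanPairing X (Y i) (varifoldWeight (V i)) =
      ∑ j ∈ F, ∫ q, g j q * B.coord j q.pt (Y i q.pt) ∂V i := fun i => by
    rw [B.tanPairing_eq_integral (hV i) hX (hY i)]
    simp only [hg]
    exact integral_finsetSum _ fun j _ => (g j).integrable_mul_memLp hp.le
      (B.memLp_coord (hY i) (fun K hK => (le_iSup (fun i =>
        lpNormOn I (Y i) p (varifoldWeight (V i)) K) i).trans_lt (hbound K hK)) j)
  have h2 : tanPairing X (fun x => ∑ᶠ j, h j x • B.field j x) (varifoldWeight W) =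
      ∑ j ∈ F, ∫ q, g j q * z j q ∂W := by
    rw [B.tanPairing_eq_integral hW hX hZ.1,
      ← integral_finsetSum _ fun j _ => (g j).integrable_mul_memLp hp.le (hz j).2.1]
    refine integral_congr_ae ?_
    filter_upwards [mem_ae_iff.2 hS0] with q hq
    rw [hgZ q fun j => h j q.pt]
    exact Finset.sum_congr rfl fun j _ => by rw [hhz j q hq]
  simp only [h1, h2]
  exact tendsto_finsetSum _ fun j _ => (hz j).2.2 (g j)

end TangentFrame

end Limit

section Perpendicular

variable {E : Type*} [NormedAddCommGroup E] [NormedSpace ℝ E] [FiniteDimensional ℝ E]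
  [MeasurableSpace E] [BorelSpace E]
  {H : Type*} [TopologicalSpace H] {I : ModelWithCorners ℝ E H} {m : ℕ}
  {U : Type*} [TopologicalSpace U] [T2Space U] [LocallyCompactSpace U] [SecondCountableTopology U]
  [ChartedSpace H U] [IsManifold I 1 U]
  [MeasurableSpace U] [BorelSpace U] [RiemannianBundle (fun x : U => TangentSpace I x)]
  [IsContinuousRiemannianBundle E (fun x : U => TangentSpace I x)]

theorem IsTestField.smul {X : ∀ q : GrassmannBundle I m U, TangentSpace I q.pt}
    (hX : IsTestField I X) {f : GrassmannBundle I m U → ℝ} (hf : Continuous f) :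
    IsTestField I (fun q => f q • X q) := by
  refine ⟨?_, hX.2.imp fun K hK => ⟨hK.1, fun q hq => by
    simp only [hK.2 q hq, smul_zero]⟩⟩
  have := TangentBundle.continuous_sum_smul (I := I) GrassmannBundle.continuous_pt
    (Finset.univ : Finset Unit) (c := fun _ => f) (fun _ => hf) (v := fun _ q => X q) fun _ => hX.1
  simpa using this

theorem tanPairing_eq_zero {X : ∀ q : GrassmannBundle I m U, TangentSpace I q.pt}
    (hX : ∀ q, X q ∈ q.plane) {Y : ∀ x : U, TangentSpace I x} {M : Measure U}
    (hY : IsPerpTan m Y M) : tanPairing X Y M = 0 := by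
  refine integral_eq_zero_of_ae ?_
  filter_upwards [hY] with x hx
  refine hx _ ?_
  unfold evalTan
  split_ifs with h
  · exact hX ⟨x, approxTan I m M x, h⟩
  · exact zero_mem _

namespace TangentFrame

variable {J : Type*} (B : TangentFrame I U J)

theorem isTestField_starProjection_field (j : J) :
    IsTestField I (fun q : GrassmannBundle I m U => q.plane.starProjection (B.field j q.pt)) := by
  refine ⟨?_, _, GrassmannBundle.isCompact_preimage_pt (B.isCompact_carrier j), fun q hq => ?_⟩
  · have h1 : Continuous fun q : GrassmannBundle I m U =>
        (⟨q.pt, B.field j q.pt⟩ : TangentBundle I U) :=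
      (B.continuous_field j).comp GrassmannBundle.continuous_pt
    exact Continuous.clm_bundle_apply (𝕜 := ℝ) (F₁ := E) (F₂ := E)
      (GrassmannBundle.continuous_proj (I := I) (m := m) (U := U)) h1
  · simp only [B.field_eq_zero j q.pt hq, map_zero]

theorem isPerpTan_of_forall_tanPairing_eq_zero (B : TangentFrame I U J) [Countable J] {p : ℝ≥0∞} (hp : 1 ≤ p)
    {W : Measure (GrassmannBundle I m U)} [IsFiniteMeasureOnCompacts W]
    (hW : ∀ᵐ q ∂W, IsApproxTangentPlane I m (varifoldWeight W) q.pt q.plane)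
    {Z : ∀ x : U, TangentSpace I x} (hZ : MemLpLocField I Z p (varifoldWeight W))
    (h : ∀ X : ∀ q : GrassmannBundle I m U, TangentSpace I q.pt, IsTestField I X →
      (∀ q, X q ∈ q.plane) → tanPairing X Z (varifoldWeight W) = 0) :
    IsPerpTan m Z (varifoldWeight W) := by
  have h1 : ∀ j, ∀ᵐ q ∂W, inner ℝ (q.plane.starProjection (B.field j q.pt)) (Z q.pt) = (0 : ℝ) := by
    intro j
    have hT := B.isTestField_starProjection_field (m := m) j
    obtain ⟨F, g, hg, -⟩ := B.exists_inner_eq_sum hT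
    have hint : Integrable (fun q : GrassmannBundle I m U =>
        (inner ℝ (q.plane.starProjection (B.field j q.pt)) (Z q.pt) : ℝ)) W := by
      simp only [hg]
      exact integrable_finsetSum _ fun j _ => (g j).integrable_mul_memLp hp
        (B.memLp_coord hZ.1 hZ.2 j)
    refine ae_eq_zero_of_forall_integral_mul_compactlySupported hint.locallyIntegrable fun f => ?_
    have hfT := hT.smul f.continuous
    rw [← h _ hfT fun q => q.plane.smul_mem _ (Submodule.starProjection_apply_mem _ _),
      B.tanPairing_eq_integral hW hfT hZ.1]
    simp only [real_inner_smul_left]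
    rfl
  have h2 : ∀ᵐ q ∂W, q ∈ {q : GrassmannBundle I m U |
      IsApproxTangentPlane I m (varifoldWeight W) q.pt q.plane ∧
        ∀ v ∈ q.plane, inner ℝ v (Z q.pt) = (0 : ℝ)} := by
    filter_upwards [hW, ae_all_iff.2 h1] with q hq hj
    refine ⟨hq, fun v hv => ?_⟩
    obtain ⟨F, hF⟩ := B.exists_finset {q.pt} isCompact_singleton
    have h3 := congrArg q.plane.starProjection ((hF q.pt rfl).2 v)
    rw [Submodule.starProjection_eq_self_iff.2 hv, map_sum] at h3
    rw [← h3, sum_inner]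
    refine Finset.sum_eq_zero fun j _ => ?_
    rw [map_smul, real_inner_smul_left, hj j, mul_zero]
  obtain ⟨S, hSA, -, hS0, hSm, -⟩ := exists_measurableSet_descend GrassmannBundle.continuous_pt W
    h2 ((GrassmannBundle.injOn_pt (varifoldWeight W)).mono fun q hq => hq.1)
  filter_upwards [mem_ae_iff.2 (varifoldWeight_compl_image_pt hS0 hSm)]
  rintro _ ⟨q, hq, rfl⟩ v hv
  rw [(hSA hq).1.eq_approxTan] at hv
  exact (hSA hq).2 v hv

end TangentFrame

end Perpendicular

theorem IsContMDiffRiemannianBundle.isContinuousRiemannianBundle {EB HB B F : Type*}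
    [NormedAddCommGroup EB] [NormedSpace ℝ EB] [TopologicalSpace HB]
    {IB : ModelWithCorners ℝ EB HB} {n : ℕ∞ω} [TopologicalSpace B] [ChartedSpace HB B]
    [NormedAddCommGroup F] [NormedSpace ℝ F] {E : B → Type*} [TopologicalSpace (TotalSpace F E)]
    [∀ x, NormedAddCommGroup (E x)] [∀ x, InnerProductSpace ℝ (E x)]
    [FiberBundle F E] [VectorBundle ℝ F E] [IsContMDiffRiemannianBundle IB n F E] :
    IsContinuousRiemannianBundle F E := by
  obtain ⟨g, hg, hgE⟩ := IsContMDiffRiemannianBundle.exists_contMDiff (IB := IB) (n := n) (F := F)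
    (E := E)
  exact ⟨g, hg.continuous, hgE⟩

end

theorem theorem3p1
    {E : Type*} [NormedAddCommGroup E] [NormedSpace ℝ E] [FiniteDimensional ℝ E]
    [MeasurableSpace E] [BorelSpace E]
    {H : Type*} [TopologicalSpace H] (I : ModelWithCorners ℝ E H)
    {U : Type*} [EMetricSpace U] [SecondCountableTopology U] [ChartedSpace H U]
    [MeasurableSpace U] [BorelSpace U] [IsManifold I ∞ U]
    [RiemannianBundle (fun x : U => TangentSpace I x)]
    [IsContMDiffRiemannianBundle I ∞ E (fun x : U => TangentSpace I x)]
    [IsRiemannianManifold I U]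
    (m : ℕ) (p : ℝ≥0∞) (hp : 1 < p)
    (V : ℕ → Measure (GrassmannBundle I m U)) (W : Measure (GrassmannBundle I m U))
    (hV : ∀ i, IsRectifiableVarifold (V i)) (hW : IsRectifiableVarifold W)
    (hVW : VarifoldTendsto V W)
    (Y : ℕ → ∀ x : U, TangentSpace I x) (hY : ∀ i, IsBorelField I (Y i))
    (hbound : ∀ K : Set U, IsCompact K → (⨆ i, lpNormOn I (Y i) p (varifoldWeight (V i)) K) < ⊤) :
    (∃ φ : ℕ → ℕ, StrictMono φ ∧ ∃ Z : ∀ x : U, TangentSpace I x,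
      MemLpLocField I Z p (varifoldWeight W) ∧
      ∀ X : ∀ q : GrassmannBundle I m U, TangentSpace I q.pt, IsTestField I X →
        Tendsto (fun j => tanPairing X (Y (φ j)) (varifoldWeight (V (φ j)))) atTop
          (𝓝 (tanPairing X Z (varifoldWeight W)))) ∧
    ((∀ i, IsPerpTan m (Y i) (varifoldWeight (V i))) →
      ∀ φ : ℕ → ℕ, StrictMono φ → ∀ Z : ∀ x : U, TangentSpace I x,
        MemLpLocField I Z p (varifoldWeight W) →
        (∀ X : ∀ q : GrassmannBundle I m U, TangentSpace I q.pt, IsTestField I X →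
          Tendsto (fun j => tanPairing X (Y (φ j)) (varifoldWeight (V (φ j)))) atTop
            (𝓝 (tanPairing X Z (varifoldWeight W)))) →
        IsPerpTan m Z (varifoldWeight W)) := by
  have : IsManifold I 1 U := IsManifold.of_le (n := ∞) (by simp)
  have : LocallyCompactSpace U := Manifold.locallyCompact_of_finiteDimensional I
  have : IsContinuousRiemannianBundle E (fun x : U => TangentSpace I x) :=
    IsContMDiffRiemannianBundle.isContinuousRiemannianBundle (IB := I) (n := ∞)
  have : ∀ i, IsFiniteMeasureOnCompacts (V i) := fun i => (hV i).finiteOnCompacts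
  have : IsFiniteMeasureOnCompacts W := hW.finiteOnCompacts
  obtain ⟨t, ht, ⟨B⟩⟩ := exists_tangentFrame I U
  have : Countable t := ht.to_subtype
  refine ⟨B.exists_subseq_tendsto_tanPairing hp (fun i => (hV i).ae_tangent) hW.ae_tangent hVW hY
    hbound, fun hperp φ _ Z hZ hlim => ?_⟩
  refine B.isPerpTan_of_forall_tanPairing_eq_zero hp.le hW.ae_tangent hZ fun X hX hXP => ?_
  have h1 := hlim X hX
  simp only [fun i => tanPairing_eq_zero hXP (hperp i)] at h1
  exact tendsto_nhds_unique h1 tendsto_const_nhds
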